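/- Let $d$ be a square-free positive integer, $K=\mathbb{Q}(\sqrt{-d})$, and let $\mathcal{O}$ be an order in $K$. Let $p$ be a prime that is inert in $K$ and satisfies $p>|\operatorname{disc}(\mathcal{O})|$. Let $B=\left(\frac{-d,-p}{\mathbb{Q}}\right)$ be the quaternion algebra with standard basis $\{1,i,j,k\}$, $i^2=-d$, $j^2=-p$, $k=ij=-ji$, and assume that $B$ is ramified precisely at $p$ and $\infty$. Identify $K$ with the subfield $\mathbb{Q}(i)$ of $B$ (so that $\sqrt{-d}=i$), and put $\Lambda=\mathcal{O}+j\mathcal{O}$. For a prime $\ell$, let $K_\ell$, $B_\ell$, $\mathcal{O}_\ell$, $\Lambda_\ell$ denote the $\ell$-adic completions, and put $$S_\ell^{\mathrm{opt}}=\{\mathcal{R}_\ell\subset B_\ell \mid \mathcal{R}_\ell \text{ is a maximal } \mathbb{Z}_\ell\text{-order of } B_\ell,\ \mathcal{R}_\ell\supseteq\Lambda_\ell,\ \mathcal{R}_\ell\cap K_\ell=\mathcal{O}_\ell\}.$$ Let $\ell$ be a prime factor of $\operatorname{disc}(\mathcal{O})$. Then: 1. $S_\ell^{\mathrm{opt}}\neq\emptyset$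 if and only if $-p\in N_{K/\mathbb{Q}}(\mathcal{O}_\ell^\times)$, where $N_{K/\mathbb{Q}}$ is the norm of $K_\ell$ over $\mathbb{Q}_\ell$. 2. If $S_\ell^{\mathrm{opt}}\neq\emptyset$, then there is a regular (i.e. free and transitive) action of the Galois cohomology group $H^1(K/\mathbb{Q},\mathcal{O}_\ell^\times)$ on $S_\ell^{\mathrm{opt}}$, so for every $\mathcal{R}_\ell\in S_\ell^{\mathrm{opt}}$ the orbit map $h\mapsto h\cdot\mathcal{R}_\ell$ is a bijection $H^1(K/\mathbb{Q},\mathcal{O}_\ell^\times)\simeq S_\ell^{\mathrm{opt}}$. The action can be chosen such that, whenever $z$ is a $1$-cocycle of $\operatorname{Gal}(K/\mathbb{Q})$ with values in $\mathcal{O}_\ell^\times$ and $c\in K_\ell^\times$ satisfies $\sigma(c)=z(\sigma)\,c$ for all $\sigma\in\operatorname{Gal}(K/\mathbb{Q})$, the class of $z$ sends each $\mathcal{R}_\ell\in S_\ell^{\mathrm{opt}}$ to $c\,\mathcal{R}_\ell\,c^{-1}$. -/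

import Mathlib

open scoped Quaternion

noncomputable section

namespace OptimalOrders

/-- The quadratic algebra `F(√-d) = F ⊕ F ω` with `ω ^ 2 = -d`. For `F = ℚ` and `d` a positive
integer this is the imaginary quadratic field `K = ℚ(√-d)` (see `noZeroDivisors_K`), and for a field
`F` of characteristic zero it is `F ⊗ K`; in particular it is the completion `K_ℓ` for `F = ℚ_ℓ`. -/
abbrev K (F : Type) [Field F] (d : ℕ) : Type := QuadraticAlgebra F (-(d : F)) 0

/-- The quaternion algebra `(-d, -p / F)`, with standard basis `1, i, j, k = ij = -ji` satisfying
`i ^ 2 = -d` and `j ^ 2 = -p`. For `F = ℚ` this is `B`, and for a field `F` of characteristic zero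
it is `F ⊗ B`; in particular it is the completion `B_ℓ` for `F = ℚ_ℓ`. -/
abbrev B (F : Type) [Field F] (d p : ℕ) : Type := ℍ[F, -(d : F), -(p : F)]

/-- The canonical map from `K` to `F ⊗ K`. -/
def baseK (F : Type) [Field F] [CharZero F] (d : ℕ) : K ℚ d →+* K F d where
  toFun x := ⟨(x.re : F), (x.im : F)⟩
  map_one' := by ext <;> simp [QuadraticAlgebra.re_one, QuadraticAlgebra.im_one]
  map_mul' x y := by ext <;> simp
  map_zero' := by ext <;> simp
  map_add' x y := by ext <;> simp

/-- The canonical map from `B` to `F ⊗ B`. -/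
def baseB (F : Type) [Field F] [CharZero F] (d p : ℕ) : B ℚ d p →+* B F d p where
  toFun x := ⟨(x.re : F), (x.imI : F), (x.imJ : F), (x.imK : F)⟩
  map_one' := by ext <;> simp
  map_mul' x y := by ext <;> simp
  map_zero' := by ext <;> simp
  map_add' x y := by ext <;> simp

/-- The quaternion algebra `B` is ramified at the place of `ℚ` with completion `F` if `F ⊗ B` is not
split, i.e. is not isomorphic to the matrix algebra `M₂(F)`. -/
def IsRamifiedAt (F : Type) [Field F] (d p : ℕ) : Prop :=
  ¬ Nonempty (B F d p ≃ₐ[F] Matrix (Fin 2) (Fin 2) F)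

/-- `B` is ramified precisely at the prime `p` and at infinity. -/
def IsRamifiedPreciselyAtPAndInfinity (d p : ℕ) : Prop :=
  IsRamifiedAt ℝ d p ∧ ∀ (q : ℕ) [Fact q.Prime], IsRamifiedAt ℚ_[q] d p ↔ q = p

/-- The identification of `F(√-d)` with the subalgebra `F(i)` of `(-d, -p / F)`, under which `√-d`
becomes `i`. -/
def toB (F : Type) [Field F] (d p : ℕ) : K F d →ₐ[F] B F d p where
  toFun x := ⟨x.re, x.im, 0, 0⟩
  map_one' := by ext <;> simp [QuadraticAlgebra.re_one, QuadraticAlgebra.im_one]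
  map_mul' x y := by ext <;> simp
  map_zero' := by ext <;> simp
  map_add' x y := by ext <;> simp
  commutes' r := by
    ext <;> simp [QuadraticAlgebra.algebraMap_eq, QuaternionAlgebra.algebraMap_eq]

/-- The standard generator `j` of `B`, with `j ^ 2 = -p`. -/
def jElt (d p : ℕ) : B ℚ d p := ⟨0, 0, 1, 0⟩

/-- For a domain `R` with fraction field `F`, an `R`-order in an `F`-algebra `A` is an
`R`-subalgebra which is finitely generated as an `R`-module and spans `A` over `F`. -/
def IsOrder (R F : Type) [CommRing R] [Field F] [Algebra R F] {A : Type} [Ring A] [Algebra R A]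
    [Algebra F A] [IsScalarTower R F A] (S : Subalgebra R A) : Prop :=
  Submodule.IsLattice F (Subalgebra.toSubmodule S)

/-- The discriminant of an order of rank two: the discriminant of any `ℤ`-basis of it
(see `nonempty_basis` for the existence of a basis and `disc_eq` for independence of its choice). -/
def disc {d : ℕ} (O : Subalgebra ℤ (K ℚ d)) : ℤ :=
  open Classical in
  if h : Nonempty (Module.Basis (Fin 2) ℤ O) then Algebra.discr ℤ h.some else 0

theorem disc_eq {d : ℕ} (O : Subalgebra ℤ (K ℚ d)) (b : Module.Basis (Fin 2) ℤ O) :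
    disc O = Algebra.discr ℤ b := by
  have h : Nonempty (Module.Basis (Fin 2) ℤ O) := ⟨b⟩
  rw [disc, dif_pos h]
  exact Algebra.discr_eq_discr O h.some b

/-- Every order of `K` has a `ℤ`-basis with two elements. -/
theorem nonempty_basis {d : ℕ} (O : Subalgebra ℤ (K ℚ d)) (hO : IsOrder ℤ ℚ O) :
    Nonempty (Module.Basis (Fin 2) ℤ O) := by
  have : Submodule.IsLattice ℚ (Subalgebra.toSubmodule O) := hO
  have hfin : Module.Finite ℤ O := Submodule.IsLattice.finite ℚ (Subalgebra.toSubmodule O)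
  have hfree : Module.Free ℤ O := Submodule.IsLattice.free ℚ (Subalgebra.toSubmodule O)
  have hr : Module.rank ℤ O = Module.rank ℚ (K ℚ d) :=
    Submodule.IsLattice.rank' ℚ (Subalgebra.toSubmodule O)
  have h2 : Module.finrank ℤ O = 2 := by
    rw [Module.finrank, hr, QuadraticAlgebra.rank_eq_two]
    simp
  exact ⟨Module.finBasisOfFinrankEq ℤ O h2⟩

/-- The prime `p` is inert in `K`: it generates a prime ideal of the ring of integers. -/
def IsInert (d p : ℕ) : Prop :=
  (Ideal.span {((p : ℕ) : integralClosure ℤ (K ℚ d))}).IsPrime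

/-- `Λ = O + j O`. -/
def Lam {d : ℕ} (p : ℕ) (O : Subalgebra ℤ (K ℚ d)) : Submodule ℤ (B ℚ d p) :=
  (Subalgebra.toSubmodule O).map ((toB ℚ d p).toLinearMap.restrictScalars ℤ) ⊔
    (Subalgebra.toSubmodule O).map
      ((LinearMap.mulLeft ℤ (jElt d p)) ∘ₗ ((toB ℚ d p).toLinearMap.restrictScalars ℤ))

/-- The completion `O_ℓ ⊆ K_ℓ`: the `ℤ_ℓ`-subalgebra generated by `O`, which is also the
`ℤ_ℓ`-span of `O` (see `toSubmodule_OAt`). -/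
def OAt (l : ℕ) [Fact l.Prime] {d : ℕ} (O : Subalgebra ℤ (K ℚ d)) :
    Subalgebra ℤ_[l] (K ℚ_[l] d) :=
  Algebra.adjoin ℤ_[l] (baseK ℚ_[l] d '' O)

theorem toSubmodule_OAt (l : ℕ) [Fact l.Prime] {d : ℕ} (O : Subalgebra ℤ (K ℚ d)) :
    Subalgebra.toSubmodule (OAt l O) = Submodule.span ℤ_[l] (baseK ℚ_[l] d '' O) := by
  have h : baseK ℚ_[l] d '' O =
      ((O.toSubmonoid.map (baseK ℚ_[l] d).toMonoidHom : Submonoid (K ℚ_[l] d)) :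
        Set (K ℚ_[l] d)) := rfl
  rw [OAt, Algebra.adjoin_eq_span, h, Submonoid.closure_eq]

/-- The completion `Λ_ℓ ⊆ B_ℓ`, the `ℤ_ℓ`-span of `Λ`. -/
def LamAt (l : ℕ) [Fact l.Prime] {d : ℕ} (p : ℕ) (O : Subalgebra ℤ (K ℚ d)) :
    Submodule ℤ_[l] (B ℚ_[l] d p) :=
  Submodule.span ℤ_[l] (baseB ℚ_[l] d p '' Lam p O)

/-- The set of maximal orders `R` of `B_ℓ` which contain `Λ_ℓ` and satisfy `R ∩ K_ℓ = O_ℓ`. -/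
def SOpt (l : ℕ) [Fact l.Prime] {d : ℕ} (p : ℕ) (O : Subalgebra ℤ (K ℚ d)) :
    Set (Subalgebra ℤ_[l] (B ℚ_[l] d p)) :=
  {R | Maximal (IsOrder ℤ_[l] ℚ_[l]) R ∧ LamAt l p O ≤ Subalgebra.toSubmodule R ∧
    R.comap ((toB ℚ_[l] d p).restrictScalars ℤ_[l]) = OAt l O}

/-- The action of an element `s` of the Galois group of `K / ℚ` on `F ⊗ K`, through the factor `K`:
the `F`-linear extension of `s` (see `galAt_baseK`). -/
def galAt (F : Type) [Field F] [CharZero F] {d : ℕ} (s : K ℚ d ≃ₐ[ℚ] K ℚ d) :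
    K F d →ₐ[F] K F d :=
  QuadraticAlgebra.lift ⟨baseK F d (s QuadraticAlgebra.omega), by
    have h : (QuadraticAlgebra.omega : K ℚ d) * QuadraticAlgebra.omega =
        algebraMap ℚ (K ℚ d) (-(d : ℚ)) := by
      rw [QuadraticAlgebra.omega_mul_omega_eq_mk]; rfl
    rw [← map_mul, ← map_mul, h, AlgEquiv.commutes]
    ext <;> simp [baseK, QuadraticAlgebra.algebraMap_eq, QuadraticAlgebra.re_one,
      QuadraticAlgebra.im_one]⟩

theorem galAt_apply (F : Type) [Field F] [CharZero F] {d : ℕ} (s : K ℚ d ≃ₐ[ℚ] K ℚ d)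
    (x : K F d) : galAt F s x = x.re • 1 + x.im • baseK F d (s QuadraticAlgebra.omega) := rfl

theorem galAt_baseK (F : Type) [Field F] [CharZero F] {d : ℕ} (s : K ℚ d ≃ₐ[ℚ] K ℚ d)
    (x : K ℚ d) : galAt F s (baseK F d x) = baseK F d (s x) := by
  have h : s x = x.re • 1 + x.im • s QuadraticAlgebra.omega := by
    conv_lhs => rw [show x = x.re • (1 : K ℚ d) + x.im • QuadraticAlgebra.omega by
      ext <;> simp [QuadraticAlgebra.re_one, QuadraticAlgebra.im_one]]
    rw [map_add, map_smul, map_smul, map_one]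
  rw [galAt_apply, h]
  ext <;> simp [baseK, QuadraticAlgebra.re_one, QuadraticAlgebra.im_one]

theorem galAt_one (F : Type) [Field F] [CharZero F] {d : ℕ} (x : K F d) :
    galAt F (1 : K ℚ d ≃ₐ[ℚ] K ℚ d) x = x := by
  rw [galAt_apply]
  ext <;> simp [baseK, QuadraticAlgebra.re_one, QuadraticAlgebra.im_one]

theorem galAt_mul (F : Type) [Field F] [CharZero F] {d : ℕ} (s t : K ℚ d ≃ₐ[ℚ] K ℚ d)
    (x : K F d) : galAt F (s * t) x = galAt F s (galAt F t x) := by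
  rw [galAt_apply F t, map_add, map_smul, map_smul, map_one, galAt_baseK, galAt_apply]
  rfl

/-! ### The Galois action preserves `O` and `O_ℓ` -/

theorem noZeroDivisors_K {d : ℕ} (hd : 0 < d) : NoZeroDivisors (K ℚ d) := by
  have : Fact (∀ r : ℚ, r ^ 2 ≠ -(d : ℚ) + 0 * r) := ⟨fun r h => by
    have h1 : (0 : ℚ) < d := by exact_mod_cast hd
    nlinarith [sq_nonneg r]⟩
  infer_instance

theorem gal_mem {d : ℕ} (hd : 0 < d) {O : Subalgebra ℤ (K ℚ d)} (hO : IsOrder ℤ ℚ O)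
    (s : K ℚ d ≃ₐ[ℚ] K ℚ d) {x : K ℚ d} (hx : x ∈ O) : s x ∈ O := by
  have := noZeroDivisors_K hd
  have hint : IsIntegral ℤ x := IsIntegral.of_mem_of_fg O hO.fg x hx
  have hint' : IsIntegral ℤ (star x) := hint.map (starRingEnd (K ℚ d)).toIntAlgHom
  have hsum : x + star x = algebraMap ℚ (K ℚ d) x.trace :=
    (QuadraticAlgebra.algebraMap_trace_eq_add_star x).symm
  have htr : IsIntegral ℤ x.trace := by
    have h := hint.add hint'
    rw [hsum] at h
    exact (isIntegral_algebraMap_iff (FaithfulSMul.algebraMap_injective ℚ (K ℚ d))).1 h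
  obtain ⟨n, hn⟩ := IsIntegrallyClosed.isIntegral_iff.1 htr
  have hstar : star x = algebraMap ℤ (K ℚ d) n - x := by
    rw [IsScalarTower.algebraMap_apply ℤ ℚ (K ℚ d), hn, ← hsum]
    ring
  have hmem : star x ∈ O := by
    rw [hstar]
    exact O.sub_mem (O.algebraMap_mem n) hx
  have hnorm : x * star x = algebraMap ℚ (K ℚ d) x.norm :=
    (QuadraticAlgebra.algebraMap_norm_eq_mul_star x).symm
  have h0 : (s x - x) * (s x - star x) = 0 := by
    have h1 : s x + s (star x) = x + star x := by
      rw [← map_add, hsum, AlgEquiv.commutes]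
    have h2 : s x * s (star x) = x * star x := by
      rw [← map_mul, hnorm, AlgEquiv.commutes]
    linear_combination (s x) * h1 - h2
  rcases mul_eq_zero.1 h0 with h | h
  · rwa [sub_eq_zero.1 h]
  · rwa [sub_eq_zero.1 h]

theorem galAt_mem {d : ℕ} (hd : 0 < d) {O : Subalgebra ℤ (K ℚ d)} (hO : IsOrder ℤ ℚ O)
    (l : ℕ) [Fact l.Prime] (s : K ℚ d ≃ₐ[ℚ] K ℚ d) {x : K ℚ_[l] d} (hx : x ∈ OAt l O) :
    galAt ℚ_[l] s x ∈ OAt l O := by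
  have h : OAt l O ≤ (OAt l O).comap ((galAt ℚ_[l] s).restrictScalars ℤ_[l]) := by
    refine Algebra.adjoin_le ?_
    rintro _ ⟨y, hy, rfl⟩
    refine Algebra.subset_adjoin ⟨s y, gal_mem hd hO s hy, ?_⟩
    exact (galAt_baseK _ s y).symm
  exact h hx

/-- The action of the Galois group of `K / ℚ` on `O_ℓ`. -/
def galOAt {d : ℕ} (hd : 0 < d) {O : Subalgebra ℤ (K ℚ d)} (hO : IsOrder ℤ ℚ O)
    (l : ℕ) [Fact l.Prime] (s : K ℚ d ≃ₐ[ℚ] K ℚ d) : OAt l O →ₐ[ℤ_[l]] OAt l O :=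
  (((galAt ℚ_[l] s).restrictScalars ℤ_[l]).comp (OAt l O).val).codRestrict (OAt l O)
    (fun x => galAt_mem hd hO l s x.2)

/-- The representation of `Gal(K / ℚ)` on the unit group `O_ℓˣ`, written additively. -/
def unitsRepresentation {d : ℕ} (hd : 0 < d) {O : Subalgebra ℤ (K ℚ d)} (hO : IsOrder ℤ ℚ O)
    (l : ℕ) [Fact l.Prime] :
    Representation ℤ (K ℚ d ≃ₐ[ℚ] K ℚ d) (Additive (OAt l O)ˣ) where
  toFun s := (MonoidHom.toAdditive (Units.map (galOAt hd hO l s).toMonoidHom)).toIntLinearMap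
  map_one' := by
    refine LinearMap.ext fun u => Additive.toMul.injective (Units.ext (Subtype.ext ?_))
    exact galAt_one _ _
  map_mul' s t := by
    refine LinearMap.ext fun u => Additive.toMul.injective (Units.ext (Subtype.ext ?_))
    exact galAt_mul _ _ _ _

/-- The Galois module `O_ℓˣ`. -/
abbrev unitsRep {d : ℕ} (hd : 0 < d) {O : Subalgebra ℤ (K ℚ d)} (hO : IsOrder ℤ ℚ O)
    (l : ℕ) [Fact l.Prime] : Rep ℤ (K ℚ d ≃ₐ[ℚ] K ℚ d) :=
  Rep.of (unitsRepresentation hd hO l)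

/-- The underlying element of `K_ℓ` of the value at `s` of a `1`-cocycle `z` of `Gal(K / ℚ)` with
values in `O_ℓˣ`. -/
def cocycleValue {d : ℕ} (hd : 0 < d) {O : Subalgebra ℤ (K ℚ d)} (hO : IsOrder ℤ ℚ O)
    (l : ℕ) [Fact l.Prime] (z : groupCohomology.cocycles₁ (unitsRep hd hO l))
    (s : K ℚ d ≃ₐ[ℚ] K ℚ d) : K ℚ_[l] d :=
  ((Additive.toMul (z s : Additive (OAt l O)ˣ) : (OAt l O)ˣ) : OAt l O)

end OptimalOrders

end

open OptimalOrders

/-! Since `l` divides the nonzero integer `disc O` and `|disc O| < p`, the prime `l` differs from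
`p`. Hence `B` splits at `l`, and `-p` is a unit of `ℤ_[l]`. Splitting gives `a` in `K_ℓ` with `a *
star a = -p`, and `B_ℓ` becomes `End K_ℓ`: `K_ℓ` acts by multiplication and `j` by `v ↦ a * star v`
(`actionEquiv`).

Maximal orders are the stabilizers of lattices `L` in `K_ℓ` (`maximal_stabilizer`,
`exists_eq_stabilizer`), and `L` is determined up to homothety
(`exists_homothety_of_stabilizer_eq`). The intersection of such an order with `K_ℓ` is the
multiplier ring of `L`. A lattice in a quadratic algebra is principal over its multiplier ring
(`exists_eq_mul_of_multiplier_eq`), so optimality forces `L = c O_ℓ`. Then `j` preserves `L` exactly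
when `u = c⁻¹ a star c` lies in `O_ℓ`. As `u` has norm `-p`, it is then a unit of `O_ℓ`; conversely,
if `a` itself is a unit of `O_ℓ`, the stabilizer of `O_ℓ` is optimal. This is the first claim.

For the second, any two optimal orders are conjugate by some `c` with `star c / c` in `O_ℓ`, and `c`
fixes an order exactly when it lies in `ℚ_ℓˣ O_ℓˣ`. By Hilbert 90 over `K_ℓ`, sending `c` to the
cocycle `s ↦ s(c) / c` identifies the group of these `c` modulo `ℚ_ℓˣ O_ℓˣ` with `H¹` of `O_ℓˣ`
(`exists_isTrivializedBy`, `exists_isTrivializedBy_of_mem`, `IsTrivializedBy.H1π_eq_zero_iff`). -/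

noncomputable section

namespace OptimalOrders

/-! ### Maximal orders of a split algebra -/

section Stabilizer

variable {R F A V : Type} [CommRing R] [Field F] [Algebra R F] [Ring A] [Algebra R A] [Algebra F A]
  [IsScalarTower R F A] [AddCommGroup V] [Module F V] [Module R V] [IsScalarTower R F V]

/-- The subalgebra of the elements of `A ≃ End V` which map `L` into itself. -/
def stabilizer (e : A ≃ₐ[F] Module.End F V) (L : Submodule R V) : Subalgebra R A where
  carrier := {x | ∀ v ∈ L, e x v ∈ L}
  mul_mem' {x y} hx hy v hv := by
    rw [map_mul]
    exact hx _ (hy v hv)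
  add_mem' {x y} hx hy v hv := by
    rw [map_add]
    exact L.add_mem (hx v hv) (hy v hv)
  algebraMap_mem' r v hv := by
    rw [IsScalarTower.algebraMap_apply R F A, AlgEquiv.commutes, Module.algebraMap_end_apply,
      algebraMap_smul]
    exact L.smul_mem r hv

theorem mem_stabilizer {e : A ≃ₐ[F] Module.End F V} {L : Submodule R V} {x : A} :
    x ∈ stabilizer e L ↔ ∀ v ∈ L, e x v ∈ L := Iff.rfl

theorem IsLattice.map {W : Type} [AddCommGroup W] [Module F W] [Module R W] [IsScalarTower R F W]
    {L : Submodule R V} (hL : Submodule.IsLattice F L) {f : V →ₗ[F] W}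
    (hf : Function.Surjective f) : Submodule.IsLattice F (L.map (f.restrictScalars R)) where
  fg := hL.fg.map _
  span_eq_top := by
    rw [Submodule.map_coe, LinearMap.coe_restrictScalars, ← Submodule.map_span, hL.span_eq_top,
      Submodule.map_top, LinearMap.range_eq_top.2 hf]

theorem IsOrder.comap {A' : Type} [Ring A'] [Algebra R A'] [Algebra F A'] [IsScalarTower R F A']
    {S : Subalgebra R A'} (hS : IsOrder R F S) (f : A ≃ₐ[F] A') :
    IsOrder R F (S.comap ((f : A →ₐ[F] A').restrictScalars R)) := by
  have h := IsLattice.map (R := R) hS (f := f.symm.toLinearMap) f.symm.surjective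
  have heq : Subalgebra.toSubmodule (S.comap ((f : A →ₐ[F] A').restrictScalars R)) =
      (Subalgebra.toSubmodule S).map (f.symm.toLinearMap.restrictScalars R) := by
    ext x
    constructor
    · intro hx
      exact ⟨f x, hx, f.symm_apply_apply x⟩
    · rintro ⟨y, hy, rfl⟩
      change f (f.symm y) ∈ S
      rwa [f.apply_symm_apply]
  rw [IsOrder, heq]
  exact h

theorem maximal_isOrder_comap {A' : Type} [Ring A'] [Algebra R A'] [Algebra F A']
    [IsScalarTower R F A'] {S : Subalgebra R A'} (hS : Maximal (IsOrder R F) S) (f : A ≃ₐ[F] A') :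
    Maximal (IsOrder R F) (S.comap ((f : A →ₐ[F] A').restrictScalars R)) := by
  refine ⟨IsOrder.comap hS.1 f, fun T hT hle x hx => ?_⟩
  refine hS.2 (IsOrder.comap hT f.symm) (fun y hy => ?_) (?_ : f x ∈ _)
  · refine hle (?_ : f (f.symm y) ∈ S)
    rwa [f.apply_symm_apply]
  · change f.symm (f x) ∈ T
    rwa [f.symm_apply_apply]

/-- These rank-one operators are the test elements from which `L` is recovered, both for maximality
of the stabilizer and for uniqueness of `L` up to homothety. -/
theorem smulRight_mem_stabilizer (e : A ≃ₐ[F] Module.End F V) {L : Submodule R V} {f : V →ₗ[F] F}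
    (hf : ∀ v ∈ L, f v ∈ Set.range (algebraMap R F)) {w : V} (hw : w ∈ L) :
    e.symm (f.smulRight w) ∈ stabilizer e L := by
  intro v hv
  obtain ⟨r, hr⟩ := hf v hv
  rw [e.apply_symm_apply, LinearMap.smulRight_apply, ← hr, algebraMap_smul]
  exact L.smul_mem r hw

variable [IsDomain R] [IsFractionRing R F]

theorem exists_smul_mem {L : Submodule R V} (hL : Submodule.IsLattice F L) (v : V) :
    ∃ r : R, r ≠ 0 ∧ r • v ∈ L := by
  have hv : v ∈ Submodule.span F (L : Set V) := by rw [hL.span_eq_top]; trivial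
  induction hv using Submodule.span_induction with
  | mem x hx => exact ⟨1, one_ne_zero, by rwa [one_smul]⟩
  | zero => exact ⟨1, one_ne_zero, by simp⟩
  | add x y _ _ hx hy =>
    obtain ⟨r, hr, hx⟩ := hx
    obtain ⟨s, hs, hy⟩ := hy
    refine ⟨r * s, mul_ne_zero hr hs, ?_⟩
    rw [smul_add]
    refine L.add_mem ?_ ?_
    · rw [mul_comm, mul_smul]
      exact L.smul_mem _ hx
    · rw [mul_smul]
      exact L.smul_mem _ hy
  | smul a x _ hx =>
    obtain ⟨r, hr, hx⟩ := hx
    obtain ⟨m, n, hn, rfl⟩ := IsFractionRing.div_surjective (A := R) a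
    have hn0 : algebraMap R F n ≠ 0 :=
      IsFractionRing.to_map_ne_zero_of_mem_nonZeroDivisors hn
    refine ⟨n * r, mul_ne_zero (nonZeroDivisors.ne_zero hn) hr, ?_⟩
    have h : (n * r) • (algebraMap R F m / algebraMap R F n) • x = m • r • x := by
      simp only [← algebraMap_smul F (_ : R) (_ : V), ← mul_smul, map_mul]
      congr 1
      field_simp
    rw [h]
    exact L.smul_mem _ hx

theorem exists_smul_mem_of_finite {ι : Type} [Fintype ι] {L : Submodule R V}
    (hL : Submodule.IsLattice F L) (v : ι → V) : ∃ r : R, r ≠ 0 ∧ ∀ i, r • v i ∈ L := by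
  classical
  choose r hr hv using fun i => exists_smul_mem hL (v i)
  refine ⟨∏ i, r i, Finset.prod_ne_zero_iff.2 fun i _ => hr i, fun i => ?_⟩
  rw [← Finset.prod_erase_mul _ _ (Finset.mem_univ i), mul_smul]
  exact L.smul_mem _ (hv i)

variable [IsPrincipalIdealRing R]

theorem exists_basis_of_isLattice [FiniteDimensional F V] {L : Submodule R V}
    (hL : Submodule.IsLattice F L) :
    ∃ b : Module.Basis (Fin (Module.finrank F V)) F V, L = Submodule.span R (Set.range b) := by
  have : Module.IsTorsionFree R F := inferInstance
  have hfin := Submodule.IsLattice.finite F L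
  have hfree : Module.Free R L := Submodule.IsLattice.free F L
  have hr : Module.finrank R L = Module.finrank F V := by
    rw [Module.finrank, Submodule.IsLattice.rank' F L, Module.finrank]
  let b := Module.finBasisOfFinrankEq R L hr
  refine ⟨b.extendOfIsLattice F, ?_⟩
  have h : Set.range (b.extendOfIsLattice F) = L.subtype '' Set.range b := by
    rw [← Set.range_comp]
    congr 1
    ext i
    simp
  rw [h, ← Submodule.map_span, b.span_eq, Submodule.map_top, Submodule.range_subtype]

/-- Evaluation on a basis embeds the stabilizer in a finite power of `L`, which gives finite
generation over the Noetherian ring `R`. It spans because clearing denominators moves the images of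
the basis into `L`. -/
theorem isOrder_stabilizer [FiniteDimensional F V] (e : A ≃ₐ[F] Module.End F V)
    {L : Submodule R V} (hL : Submodule.IsLattice F L) : IsOrder R F (stabilizer e L) := by
  obtain ⟨b, hb⟩ := exists_basis_of_isLattice hL
  have hbL (i) : b i ∈ L := by
    rw [hb]
    exact Submodule.subset_span ⟨i, rfl⟩
  constructor
  · let f : Subalgebra.toSubmodule (stabilizer e L) →ₗ[R] (Fin (Module.finrank F V) → L) :=
      { toFun x i := ⟨e x.1 (b i), x.2 _ (hbL i)⟩
        map_add' x y := by
          ext i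
          simp
        map_smul' r x := by
          ext i
          simp only [Submodule.coe_smul, RingHom.id_apply, Pi.smul_apply]
          rw [← algebraMap_smul F r (x : A), map_smul, LinearMap.smul_apply, algebraMap_smul] }
    have hf : Function.Injective f := by
      intro x y hxy
      refine Subtype.ext (e.injective (b.ext fun i => ?_))
      exact congrArg Subtype.val (congrFun hxy i)
    have := Submodule.IsLattice.finite F L
    exact Module.Finite.iff_fg.1 (Module.Finite.of_injective f hf)
  · refine eq_top_iff.2 fun x _ => ?_
    obtain ⟨r, hr, hx⟩ := exists_smul_mem_of_finite hL (fun i => e x (b i))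
    have hr' : algebraMap R F r ≠ 0 := by
      rwa [Ne, FaithfulSMul.algebraMap_eq_zero_iff]
    have hmem : r • x ∈ stabilizer e L := by
      intro v hv
      rw [hb] at hv
      induction hv using Submodule.span_induction with
      | mem y hy =>
        obtain ⟨i, rfl⟩ := hy
        rw [← algebraMap_smul F r x, map_smul, LinearMap.smul_apply, algebraMap_smul]
        exact hx i
      | zero => simp
      | add y z _ _ hy hz =>
        rw [map_add]
        exact L.add_mem hy hz
      | smul s y _ hy =>
        rw [← algebraMap_smul F s y, map_smul, algebraMap_smul]
        exact L.smul_mem _ hy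
    have h : x = (algebraMap R F r)⁻¹ • (r • x) := by
      rw [← algebraMap_smul F r x, smul_smul, inv_mul_cancel₀ hr', one_smul]
    rw [h]
    exact Submodule.smul_mem _ _ (Submodule.subset_span hmem)

/-- Let `x` lie in a larger order and `v` in `L`. The product of the rank-one operator `w ↦ bᵢ*(w)
v` with `x` is integral and has `v` as eigenvector, with eigenvalue the `i`-th coordinate of `x v`.
That coordinate is therefore integral over `R`, hence in `R`. -/
theorem maximal_stabilizer [FiniteDimensional F V] (e : A ≃ₐ[F] Module.End F V)
    {L : Submodule R V} (hL : Submodule.IsLattice F L) :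
    Maximal (IsOrder R F) (stabilizer e L) := by
  refine ⟨isOrder_stabilizer e hL, fun S hS hle x hx v hv => ?_⟩
  obtain ⟨b, hb⟩ := exists_basis_of_isLattice hL
  rw [hb, b.mem_span_iff_repr_mem R]
  intro i
  have hcoord : ∀ w ∈ L, b.coord i w ∈ Set.range (algebraMap R F) := by
    intro w hw
    rw [hb, b.mem_span_iff_repr_mem R] at hw
    exact hw i
  have hy := S.mul_mem (hle (smulRight_mem_stabilizer e hcoord hv)) hx
  have hint := IsIntegral.of_mem_of_fg S hS.fg _ hy
  rcases eq_or_ne v 0 with rfl | hv0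
  · exact ⟨0, by simp⟩
  set c : F := b.repr (e x v) i with hc
  have hev : Module.End.HasEigenvector (e (e.symm ((b.coord i).smulRight v) * x)) c v := by
    rw [Module.End.hasEigenvector_iff, Module.End.mem_eigenspace_iff]
    refine ⟨?_, hv0⟩
    rw [map_mul, e.apply_symm_apply, Module.End.mul_apply, LinearMap.smulRight_apply]
    rfl
  obtain ⟨q, hq, hq0⟩ := hint
  have h0 : Polynomial.aeval (e (e.symm ((b.coord i).smulRight v) * x))
      (q.map (algebraMap R F)) = 0 := by
    rw [Polynomial.aeval_algHom_apply, Polynomial.aeval_map_algebraMap, Polynomial.aeval_def, hq0,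
      map_zero]
  have h1 := Module.End.aeval_apply_of_hasEigenvector (p := q.map (algebraMap R F)) hev
  rw [h0, LinearMap.zero_apply, eq_comm, smul_eq_zero_iff_left hv0, Polynomial.eval_map] at h1
  exact IsIntegrallyClosed.isIntegral_iff.1 ⟨q, hq, h1⟩

/-- For any nonzero `v`, the orbit `S v` is an `S`-stable lattice, so `S` lies in its stabilizer;
maximality gives equality. -/
theorem exists_eq_stabilizer [FiniteDimensional F V] [Nontrivial V] (e : A ≃ₐ[F] Module.End F V)
    {S : Subalgebra R A} (hS : Maximal (IsOrder R F) S) :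
    ∃ L : Submodule R V, Submodule.IsLattice F L ∧ S = stabilizer e L := by
  obtain ⟨v, hv⟩ := exists_ne (0 : V)
  let f : A →ₗ[F] V := (LinearMap.applyₗ v).comp e.toLinearMap
  have hf : Function.Surjective f := by
    intro w
    obtain ⟨g, hg⟩ := Module.Projective.exists_dual_eq_one F hv
    refine ⟨e.symm (g.smulRight w), ?_⟩
    change e (e.symm (g.smulRight w)) v = w
    rw [e.apply_symm_apply, LinearMap.smulRight_apply, hg, one_smul]
  have hL := IsLattice.map (R := R) hS.1 hf
  refine ⟨_, hL, ?_⟩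
  have hle : S ≤ stabilizer e ((Subalgebra.toSubmodule S).map (f.restrictScalars R)) := by
    rintro x hx _ ⟨y, hy, rfl⟩
    refine ⟨x * y, S.mul_mem hx hy, ?_⟩
    change e (x * y) v = e x (e y v)
    rw [map_mul, Module.End.mul_apply]
  exact le_antisymm hle (hS.2 (isOrder_stabilizer e hL) hle)

end Stabilizer

/-! ### Lattices over `ℤ_[l]` -/

section Padic

variable {l : ℕ} [Fact l.Prime]

theorem mem_range_algebraMap_padicInt {x : ℚ_[l]} :
    x ∈ Set.range (algebraMap ℤ_[l] ℚ_[l]) ↔ ‖x‖ ≤ 1 :=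
  ⟨fun ⟨y, hy⟩ => hy ▸ y.2, fun h => ⟨⟨x, h⟩, rfl⟩⟩

variable {V : Type} [AddCommGroup V] [Module ℚ_[l] V] [Module ℤ_[l] V]
  [IsScalarTower ℤ_[l] ℚ_[l] V]

theorem smul_mem_of_norm_le_one {L : Submodule ℤ_[l] V} {r : ℚ_[l]} (hr : ‖r‖ ≤ 1) {v : V}
    (hv : v ∈ L) : r • v ∈ L := by
  obtain ⟨s, rfl⟩ := mem_range_algebraMap_padicInt.2 hr
  rw [algebraMap_smul]
  exact L.smul_mem s hv

theorem norm_apply_le_of_mem_span {ι : Type} {b : ι → V} (f : V →ₗ[ℚ_[l]] ℚ_[l]) {C : ℝ}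
    (hC : 0 ≤ C) (h : ∀ i, ‖f (b i)‖ ≤ C) {v : V} (hv : v ∈ Submodule.span ℤ_[l] (Set.range b)) :
    ‖f v‖ ≤ C := by
  induction hv using Submodule.span_induction with
  | mem x hx =>
    obtain ⟨i, rfl⟩ := hx
    exact h i
  | zero => simpa
  | add x y _ _ hx hy =>
    rw [map_add]
    exact (Padic.nonarchimedean _ _).trans (max_le hx hy)
  | smul r x _ hx =>
    rw [← algebraMap_smul ℚ_[l] r x, map_smul, smul_eq_mul, norm_mul]
    exact (mul_le_of_le_one_left (norm_nonneg _) r.2).trans hx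

theorem exists_max_norm_apply [FiniteDimensional ℚ_[l] V] {L : Submodule ℤ_[l] V}
    (hL : Submodule.IsLattice ℚ_[l] L) {f : V →ₗ[ℚ_[l]] ℚ_[l]} (hf : f ≠ 0) :
    ∃ v ∈ L, f v ≠ 0 ∧ ∀ w ∈ L, ‖f w‖ ≤ ‖f v‖ := by
  obtain ⟨b, rfl⟩ := exists_basis_of_isLattice hL
  obtain ⟨i, hi⟩ : ∃ i, f (b i) ≠ 0 := by
    by_contra! h
    exact hf (b.ext h)
  obtain ⟨j, -, hj⟩ := Finset.exists_max_image Finset.univ (fun j => ‖f (b j)‖)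
    ⟨i, Finset.mem_univ i⟩
  refine ⟨b j, Submodule.subset_span ⟨j, rfl⟩, fun h => hi ?_, fun w hw =>
    norm_apply_le_of_mem_span f (norm_nonneg _) (fun k => hj k (Finset.mem_univ k)) hw⟩
  have := hj i (Finset.mem_univ i)
  rwa [h, norm_zero, norm_le_zero_iff] at this

theorem exists_homothety_of_stabilizer_eq {A : Type} [Ring A] [Algebra ℤ_[l] A] [Algebra ℚ_[l] A]
    [IsScalarTower ℤ_[l] ℚ_[l] A] [FiniteDimensional ℚ_[l] V] [Nontrivial V]
    (e : A ≃ₐ[ℚ_[l]] Module.End ℚ_[l] V) {L L' : Submodule ℤ_[l] V}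
    (hL : Submodule.IsLattice ℚ_[l] L) (hL' : Submodule.IsLattice ℚ_[l] L')
    (h : stabilizer e L = stabilizer e L') :
    ∃ r : ℚ_[l], r ≠ 0 ∧ ∀ v, v ∈ L ↔ r • v ∈ L' := by
  obtain ⟨b, hb⟩ := exists_basis_of_isLattice hL
  have hcoord (i) : b.coord i ≠ 0 := fun h => by
    have := LinearMap.congr_fun h (b i)
    simp at this
  choose v hv hv0 hmax using fun i => exists_max_norm_apply hL' (hcoord i)
  have : Nonempty (Fin (Module.finrank ℚ_[l] V)) := ⟨0, Module.finrank_pos⟩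
  obtain ⟨j, -, hj⟩ := Finset.exists_max_image Finset.univ (fun j => ‖b.coord j (v j)‖)
    Finset.univ_nonempty
  -- The ratio is the largest coordinate, in a basis of `L`, of any vector of `L'`. The operator
  -- `coord j ⊗ w` sends `v j` to the multiple of `w` by this ratio; conversely, maximality bounds
  -- all coordinates of `w` by 1.
  refine ⟨b.coord j (v j), hv0 j, fun w => ⟨fun hw => ?_, fun hw => ?_⟩⟩
  · have hmem : e.symm ((b.coord j).smulRight w) ∈ stabilizer e L := by
      refine smulRight_mem_stabilizer e (fun x hx => ?_) hw
      rw [hb, b.mem_span_iff_repr_mem ℤ_[l]] at hx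
      exact hx j
    rw [h] at hmem
    have := hmem _ (hv j)
    rwa [e.apply_symm_apply, LinearMap.smulRight_apply] at this
  · rw [hb, b.mem_span_iff_repr_mem ℤ_[l]]
    intro i
    rw [mem_range_algebraMap_padicInt]
    have h1 := (hmax i _ hw).trans (hj i (Finset.mem_univ i))
    rw [map_smul, smul_eq_mul, norm_mul] at h1
    exact le_of_mul_le_mul_right (by rwa [one_mul, mul_comm]) (norm_pos_iff.2 (hv0 j))
end Padic

/-! ### The quadratic algebra `F(√-d)` -/

section Quadratic

variable {F : Type} [Field F] {d : ℕ}

theorem algebraNorm_eq_norm (x : K F d) : Algebra.norm F x = QuadraticAlgebra.norm x := by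
  rw [← QuadraticAlgebra.det_toLinearMap_eq_norm]
  rfl

theorem norm_K (x : K F d) : QuadraticAlgebra.norm x = x.re ^ 2 + d * x.im ^ 2 := by
  rw [QuadraticAlgebra.norm_def]
  ring

theorem star_smul_K (r : F) (x : K F d) : star (r • x) = r • star x := by
  ext <;> simp

/-- An element `x` with `star x = x` lies in `F`. -/
theorem exists_smul_one_of_star_eq [CharZero F] {x : K F d} (h : star x = x) :
    x = x.re • (1 : K F d) := by
  have h1 := congrArg QuadraticAlgebra.im h
  rw [QuadraticAlgebra.im_star] at h1
  ext
  · simp [QuadraticAlgebra.re_one]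
  · have h2 : x.im = 0 := by linear_combination (-1 / 2 : F) * h1
    simp [QuadraticAlgebra.im_one, h2]

/-- Hilbert's Theorem 90 for `F(√-d)`, which may be a product of two copies of `F`. -/
theorem exists_star_eq_mul [CharZero F] (hd : 0 < d) {u : K F d} (hu : u * star u = 1) :
    ∃ c : (K F d)ˣ, star (c : K F d) = u * c := by
  have hd0 : (d : F) ≠ 0 := by exact_mod_cast hd.ne'
  have hN : u.re ^ 2 + d * u.im ^ 2 = 1 := by
    rw [← norm_K, ← QuadraticAlgebra.algebraMap_inj (a := -(d : F)) (b := 0),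
      QuadraticAlgebra.algebraMap_norm_eq_mul_star, hu, map_one]
  -- The usual choice `c = 1 + star u` has norm `2 (u.re + 1)`, so it fails only for `u = -1`, where
  -- `c = ω` works.
  by_cases h : u.re = -1
  · have him : u.im = 0 := by
      rw [h] at hN
      have : (d : F) * u.im ^ 2 = 0 := by linear_combination hN
      simpa [hd0] using this
    have hunit : IsUnit (QuadraticAlgebra.omega : K F d) := by
      rw [QuadraticAlgebra.isUnit_iff_norm_isUnit, norm_K, isUnit_iff_ne_zero]
      simpa using hd0
    refine ⟨hunit.unit, ?_⟩
    rw [IsUnit.unit_spec]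
    ext <;> simp [h, him]
  · have hunit : IsUnit (1 + star u) := by
      rw [QuadraticAlgebra.isUnit_iff_norm_isUnit, norm_K, isUnit_iff_ne_zero]
      have h2 : (1 + star u).re ^ 2 + d * (1 + star u).im ^ 2 = 2 * (u.re + 1) := by
        simp [QuadraticAlgebra.re_one, QuadraticAlgebra.im_one]
        linear_combination hN
      rw [h2]
      exact mul_ne_zero two_ne_zero fun h' => h (by linear_combination h')
    refine ⟨hunit.unit, ?_⟩
    rw [IsUnit.unit_spec, star_add, star_one, star_star, mul_add, mul_one, hu, add_comm]

variable {p : ℕ}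

/-- If the quaternion algebra `(-d, -p / F)` is split, then `-p` is a norm from `F(√-d)`. -/
theorem exists_mul_star_eq_of_split [CharZero F] (hd : 0 < d)
    (h : Nonempty (B F d p ≃ₐ[F] Matrix (Fin 2) (Fin 2) F)) :
    ∃ a : K F d, a * star a = -(p : K F d) := by
  have hd0 : (d : F) ≠ 0 := by exact_mod_cast hd.ne'
  obtain ⟨e⟩ := h
  suffices H : ∃ x y : F, x ^ 2 + d * y ^ 2 = -(p : F) by
    obtain ⟨x, y, hxy⟩ := H
    refine ⟨⟨x, y⟩, ?_⟩
    ext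
    · simp
      linear_combination hxy
    · simp
      ring
  by_cases hs : ∃ s : F, s ^ 2 = -(d : F)
  · obtain ⟨s, hs⟩ := hs
    have hs0 : s ≠ 0 := by
      rintro rfl
      apply hd0
      linear_combination hs
    -- Here the norm form factors as `(x - s y)(x + s y)`; the witnesses make the factors `1` and
    -- `-p`.
    refine ⟨(1 - p) / 2, (-p - 1) / (2 * s), ?_⟩
    rw [show (d : F) = -s ^ 2 by linear_combination hs]
    field_simp
    ring
  -- A nonzero nilpotent has trace and norm zero, so its `i`, `j`, `k` coordinates satisfy `d I² + p
  -- (J² + d K²) = 0`.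
  · let x := e.symm (Matrix.single 0 1 1)
    have hx0 : x ≠ 0 := by
      intro h0
      have := e.symm.map_eq_zero_iff.1 h0
      have := congrFun (congrFun this 0) 1
      simp at this
    have hxx : x * x = 0 := by
      rw [← map_mul, Matrix.single_mul_single_of_ne _ _ _ _ (by decide), map_zero]
    have h1 := congrArg QuaternionAlgebra.re hxx
    have h2 := congrArg QuaternionAlgebra.imI hxx
    have h3 := congrArg QuaternionAlgebra.imJ hxx
    have h4 := congrArg QuaternionAlgebra.imK hxx
    simp at h1 h2 h3 h4
    have key : ∀ t : F, x.re * t + t * x.re = 0 → x.re = 0 ∨ t = 0 := by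
      intro t ht
      have : 2 * (x.re * t) = 0 := by linear_combination ht
      simpa using this
    have hre : x.re = 0 := by
      by_contra hne
      have e2 := (key x.imI (by linear_combination h2)).resolve_left hne
      have e3 := (key x.imJ (by linear_combination h3)).resolve_left hne
      have e4 := (key x.imK (by linear_combination h4)).resolve_left hne
      simp [e2, e3, e4, hne] at h1
    have hM : x.imJ ^ 2 + d * x.imK ^ 2 ≠ 0 := by
      intro hM
      have hK : x.imK = 0 := by
        by_contra hK
        refine hs ⟨x.imJ / x.imK, ?_⟩
        field_simp
        linear_combination hM
      have hJ : x.imJ = 0 := by simpa [hK] using hM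
      have hI : x.imI = 0 := by simpa [hK, hJ, hre, hd0] using h1
      exact hx0 (QuaternionAlgebra.ext hre hI hJ hK)
    -- These are the coordinates of `I ω / (J + K ω)`, whose norm is `d I² / (J² + d K²) = -p`.
    refine ⟨d * x.imI * x.imK / (x.imJ ^ 2 + d * x.imK ^ 2),
      x.imI * x.imJ / (x.imJ ^ 2 + d * x.imK ^ 2), ?_⟩
    rw [hre] at h1
    field_simp
    linear_combination -(x.imJ ^ 2 + d * x.imK ^ 2) * h1

/-- For `a` of norm `-p`, the quaternion algebra acts on `F(√-d)` by letting `i` be the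
multiplication by `√-d` and `j` the conjugation followed by the multiplication by `a`. -/
def actionHom (a : K F d) (ha : a * star a = -(p : K F d)) :
    B F d p →ₐ[F] Module.End F (K F d) :=
  QuaternionAlgebra.lift
    { i := LinearMap.mulLeft F QuadraticAlgebra.omega
      j :=
        { toFun v := a * star v
          map_add' v w := by rw [star_add, mul_add]
          map_smul' r v := by rw [star_smul_K, mul_smul_comm, RingHom.id_apply] }
      k := LinearMap.mulLeft F QuadraticAlgebra.omega *
        { toFun v := a * star v
          map_add' v w := by rw [star_add, mul_add]
          map_smul' r v := by rw [star_smul_K, mul_smul_comm, RingHom.id_apply] }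
      i_mul_i := by
        ext v <;> simp
      j_mul_j := by
        refine LinearMap.ext fun v => ?_
        have h : a * star (a * star v) = -(p : K F d) * v := by
          rw [star_mul', star_star, ← mul_assoc, ha]
        refine h.trans ?_
        ext <;> simp
      i_mul_j := rfl
      j_mul_i := by
        refine LinearMap.ext fun v => ?_
        have h : star (QuadraticAlgebra.omega : K F d) = -QuadraticAlgebra.omega := by
          ext <;> simp
        change a * star (QuadraticAlgebra.omega * v) =
          (0 : F) • (a * star v) - QuadraticAlgebra.omega * (a * star v)
        rw [star_mul', h]
        ring_nf
        simp }

theorem actionHom_apply (a : K F d) (ha : a * star a = -(p : K F d)) (x : B F d p) (v : K F d) :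
    actionHom a ha x v = ⟨x.re, x.imI⟩ * v + ⟨x.imJ, x.imK⟩ * (a * star v) := by
  have h : actionHom a ha x v = x.re • v + x.imI • (QuadraticAlgebra.omega * v) +
      x.imJ • (a * star v) + x.imK • (QuadraticAlgebra.omega * (a * star v)) := rfl
  rw [h]
  have h' (r s : F) : (⟨r, s⟩ : K F d) = r • 1 + s • QuadraticAlgebra.omega := by
    ext <;> simp [QuadraticAlgebra.re_one, QuadraticAlgebra.im_one]
  rw [h', h']
  simp only [add_mul, smul_mul_assoc, one_mul]
  abel

theorem isUnit_of_mul_star [CharZero F] (hp : p ≠ 0) {a : K F d}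
    (ha : a * star a = -(p : K F d)) : IsUnit a := by
  refine isUnit_of_mul_isUnit_left (y := star a) ?_
  rw [ha, IsUnit.neg_iff, QuadraticAlgebra.isUnit_iff_norm_isUnit, QuadraticAlgebra.norm_natCast]
  simpa using hp

/-- If `v ↦ α v + β a star v` vanishes at `1` and at `ω`, then `α + β a = 0` and `α - β a = 0`, so
`α = β = 0` because `a` is a unit. Both sides have dimension 4. -/
theorem actionHom_bijective [CharZero F] (hd : 0 < d) (hp : p ≠ 0) (a : K F d)
    (ha : a * star a = -(p : K F d)) : Function.Bijective (actionHom a ha) := by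
  have hinj : Function.Injective (actionHom a ha) := by
    rw [injective_iff_map_eq_zero]
    intro x hx
    have hd0 : (d : F) ≠ 0 := by exact_mod_cast hd.ne'
    have hω : IsUnit (QuadraticAlgebra.omega : K F d) := by
      rw [QuadraticAlgebra.isUnit_iff_norm_isUnit, norm_K, isUnit_iff_ne_zero]
      simpa using hd0
    have hsω : star (QuadraticAlgebra.omega : K F d) = -QuadraticAlgebra.omega := by
      ext <;> simp
    have h1 := LinearMap.congr_fun hx 1
    have h2 := LinearMap.congr_fun hx QuadraticAlgebra.omega
    rw [actionHom_apply, LinearMap.zero_apply] at h1 h2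
    rw [star_one, mul_one, mul_one] at h1
    rw [hsω] at h2
    have h3 : (QuadraticAlgebra.omega : K F d) *
        ((⟨x.re, x.imI⟩ : K F d) - ⟨x.imJ, x.imK⟩ * a) = 0 := by
      linear_combination h2
    rw [hω.mul_right_eq_zero] at h3
    have h4 : (2 : F) • (⟨x.re, x.imI⟩ : K F d) = 0 := by
      rw [two_smul]
      linear_combination h1 + h3
    have h5 : (⟨x.re, x.imI⟩ : K F d) = 0 := (smul_eq_zero_iff_right two_ne_zero).1 h4
    rw [h5, zero_add, (isUnit_of_mul_star hp ha).mul_left_eq_zero] at h1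
    exact QuaternionAlgebra.ext (congrArg QuadraticAlgebra.re h5) (congrArg QuadraticAlgebra.im h5)
      (congrArg QuadraticAlgebra.re h1) (congrArg QuadraticAlgebra.im h1)
  refine ⟨hinj, ?_⟩
  have hdim : Module.finrank F (B F d p) = Module.finrank F (Module.End F (K F d)) := by
    rw [Module.finrank_linearMap, QuadraticAlgebra.finrank_eq_two,
      QuaternionAlgebra.finrank_eq_four]
  exact (LinearMap.injective_iff_surjective_of_finrank_eq_finrank hdim
    (f := (actionHom a ha).toLinearMap)).1 hinj

/-- The isomorphism of the quaternion algebra with `End F(√-d)` given by `actionHom`. -/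
def actionEquiv [CharZero F] (hd : 0 < d) (hp : p ≠ 0) (a : K F d)
    (ha : a * star a = -(p : K F d)) : B F d p ≃ₐ[F] Module.End F (K F d) :=
  AlgEquiv.ofBijective (actionHom a ha) (actionHom_bijective hd hp a ha)

theorem actionEquiv_apply [CharZero F] (hd : 0 < d) (hp : p ≠ 0) (a : K F d)
    (ha : a * star a = -(p : K F d)) (x : B F d p) (v : K F d) :
    actionEquiv hd hp a ha x v = ⟨x.re, x.imI⟩ * v + ⟨x.imJ, x.imK⟩ * (a * star v) :=
  actionHom_apply a ha x v

theorem actionEquiv_toB [CharZero F] (hd : 0 < d) (hp : p ≠ 0) (a : K F d)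
    (ha : a * star a = -(p : K F d)) (x v : K F d) :
    actionEquiv hd hp a ha (toB F d p x) v = x * v := by
  rw [actionEquiv_apply]
  have h : (⟨0, 0⟩ : K F d) = 0 := rfl
  change (⟨x.re, x.im⟩ : K F d) * v + ⟨0, 0⟩ * _ = _
  rw [h, zero_mul, add_zero]

end Quadratic

/-! ### Lattices with a given multiplier ring -/

section Multiplier

variable {l : ℕ} [Fact l.Prime] {d : ℕ}

/-- On a lattice with basis `α, β` the norm is an integral combination of its values at `α`, `β` and
`α + β`, so one of these three attains the maximum. The maximum is nonzero because the lattice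
contains a nonzero scalar. -/
theorem exists_max_norm_norm {L : Submodule ℤ_[l] (K ℚ_[l] d)}
    (hL : Submodule.IsLattice ℚ_[l] L) :
    ∃ v ∈ L, QuadraticAlgebra.norm v ≠ 0 ∧
      ∀ w ∈ L, ‖QuadraticAlgebra.norm w‖ ≤ ‖QuadraticAlgebra.norm v‖ := by
  obtain ⟨b, hb⟩ := exists_basis_of_isLattice hL
  let b' := b.reindex (finCongr (QuadraticAlgebra.finrank_eq_two (R := ℚ_[l]) _ _))
  have hb' : L = Submodule.span ℤ_[l] {b' 0, b' 1} := by
    rw [hb, ← Matrix.range_cons_cons_empty _ _ ![], ← b.range_reindex]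
    congr 2
    funext i
    fin_cases i <;> rfl
  generalize b' 0 = α at hb'
  generalize b' 1 = β at hb'
  have hα : α ∈ L := hb' ▸ Submodule.subset_span (by simp)
  have hβ : β ∈ L := hb' ▸ Submodule.subset_span (by simp)
  have hle {v : K ℚ_[l] d} (h0 : ‖QuadraticAlgebra.norm α‖ ≤ ‖QuadraticAlgebra.norm v‖)
      (h1 : ‖QuadraticAlgebra.norm β‖ ≤ ‖QuadraticAlgebra.norm v‖)
      (h2 : ‖QuadraticAlgebra.norm (α + β)‖ ≤ ‖QuadraticAlgebra.norm v‖) :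
      QuadraticAlgebra.norm v ≠ 0 ∧
        ∀ w ∈ L, ‖QuadraticAlgebra.norm w‖ ≤ ‖QuadraticAlgebra.norm v‖ := by
    have hmax : ∀ w ∈ L, ‖QuadraticAlgebra.norm w‖ ≤ ‖QuadraticAlgebra.norm v‖ := by
      intro w hw
      rw [hb', Submodule.mem_span_pair] at hw
      obtain ⟨x, y, rfl⟩ := hw
      have hmul {x z : ℚ_[l]} {C : ℝ} (hx : ‖x‖ ≤ 1) (hz : ‖z‖ ≤ C) : ‖x * z‖ ≤ C := by
        rw [norm_mul]
        exact (mul_le_of_le_one_left (norm_nonneg _) hx).trans hz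
      have hadd {z z' : ℚ_[l]} {C : ℝ} (hz : ‖z‖ ≤ C) (hz' : ‖z'‖ ≤ C) : ‖z + z'‖ ≤ C :=
        (Padic.nonarchimedean _ _).trans (max_le hz hz')
      have hx : ‖algebraMap ℤ_[l] ℚ_[l] x‖ ≤ 1 := x.2
      have hy : ‖algebraMap ℤ_[l] ℚ_[l] y‖ ≤ 1 := y.2
      rw [← algebraMap_smul ℚ_[l] x, ← algebraMap_smul ℚ_[l] y]
      generalize algebraMap ℤ_[l] ℚ_[l] x = x at hx
      generalize algebraMap ℤ_[l] ℚ_[l] y = y at hy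
      have h : QuadraticAlgebra.norm (x • α + y • β) =
          x * (x * QuadraticAlgebra.norm α) + (y * (y * QuadraticAlgebra.norm β) + x * (y *
            (QuadraticAlgebra.norm (α + β) + (-QuadraticAlgebra.norm α +
              -QuadraticAlgebra.norm β)))) := by
        simp only [norm_K, QuadraticAlgebra.re_add, QuadraticAlgebra.im_add,
          QuadraticAlgebra.re_smul, QuadraticAlgebra.im_smul, smul_eq_mul]
        ring
      rw [h]
      exact hadd (hmul hx (hmul hx h0)) (hadd (hmul hy (hmul hy h1)) (hmul hx (hmul hy
        (hadd h2 (hadd (by rwa [norm_neg]) (by rwa [norm_neg]))))))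
    refine ⟨fun hv => ?_, hmax⟩
    obtain ⟨r, hr, hrL⟩ := exists_smul_mem hL (1 : K ℚ_[l] d)
    have := hmax _ hrL
    rw [hv, norm_zero, norm_le_zero_iff, norm_K] at this
    rw [← algebraMap_smul ℚ_[l] r] at this
    simp [QuadraticAlgebra.re_one, QuadraticAlgebra.im_one, hr] at this
  rcases le_total ‖QuadraticAlgebra.norm α‖ ‖QuadraticAlgebra.norm β‖ with h0 | h0
  · rcases le_total ‖QuadraticAlgebra.norm β‖ ‖QuadraticAlgebra.norm (α + β)‖ with h1 | h1
    · exact ⟨α + β, L.add_mem hα hβ, hle (h0.trans h1) h1 le_rfl⟩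
    · exact ⟨β, hβ, hle h0 le_rfl h1⟩
  · rcases le_total ‖QuadraticAlgebra.norm α‖ ‖QuadraticAlgebra.norm (α + β)‖ with h1 | h1
    · exact ⟨α + β, L.add_mem hα hβ, hle h1 (h0.trans h1) le_rfl⟩
    · exact ⟨α, hα, hle le_rfl h0 h1⟩

/-- A lattice in `K_ℓ` whose multiplier ring is `S` is principal over `S`. -/
theorem exists_eq_mul_of_multiplier_eq {L : Submodule ℤ_[l] (K ℚ_[l] d)}
    (hL : Submodule.IsLattice ℚ_[l] L) {S : Subalgebra ℤ_[l] (K ℚ_[l] d)}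
    (hS : ∀ x, x ∈ S ↔ ∀ v ∈ L, x * v ∈ L) :
    ∃ c : (K ℚ_[l] d)ˣ, ∀ v, v ∈ L ↔ (↑c⁻¹ : K ℚ_[l] d) * v ∈ S := by
  obtain ⟨α, hα, hα0, hmax⟩ := exists_max_norm_norm hL
  obtain ⟨c, rfl⟩ : IsUnit α := by
    rw [QuadraticAlgebra.isUnit_iff_norm_isUnit, isUnit_iff_ne_zero]
    exact hα0
  -- `M = c⁻¹ L` contains `1` and, by the choice of `c`, only elements of integral norm. The aim is
  -- that `M` is a ring; it then equals its own multiplier ring, which is that of `L`, namely `S`.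
  let M : Submodule ℤ_[l] (K ℚ_[l] d) := L.comap (LinearMap.mulLeft ℤ_[l] (c : K ℚ_[l] d))
  have hM (v) : v ∈ M ↔ c * v ∈ L := Iff.rfl
  have h1 : (1 : K ℚ_[l] d) ∈ M := by rwa [hM, mul_one]
  have hN {v} (hv : v ∈ M) : ‖QuadraticAlgebra.norm v‖ ≤ 1 := by
    have := hmax _ hv
    rw [LinearMap.mulLeft_apply, map_mul, norm_mul] at this
    exact le_of_mul_le_mul_left (by rwa [mul_one]) (norm_pos_iff.2 hα0)
  have htr {v} (hv : v ∈ M) : ‖2 * v.re‖ ≤ 1 := by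
    have h : 2 * v.re = QuadraticAlgebra.norm (1 + v) - (1 + QuadraticAlgebra.norm v) := by
      simp [norm_K, QuadraticAlgebra.re_one, QuadraticAlgebra.im_one]
      ring
    rw [h]
    rw [sub_eq_add_neg]
    refine (Padic.nonarchimedean _ _).trans (max_le (hN (M.add_mem h1 hv)) ?_)
    rw [norm_neg]
    refine (Padic.nonarchimedean _ _).trans (max_le ?_ (hN hv))
    rw [norm_one]
  obtain ⟨τ, hτ, hτ0, hτmax⟩ : ∃ τ ∈ M, τ.im ≠ 0 ∧ ∀ v ∈ M, ‖v.im‖ ≤ ‖τ.im‖ := by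
    let f : K ℚ_[l] d →ₗ[ℚ_[l]] ℚ_[l] :=
      (QuadraticAlgebra.imₗ _ _).comp (LinearMap.mulLeft ℚ_[l] (↑c⁻¹ : K ℚ_[l] d))
    have hf : f ≠ 0 := by
      intro h
      have := LinearMap.congr_fun h ((c : K ℚ_[l] d) * (QuadraticAlgebra.omega : K ℚ_[l] d))
      change ((↑c⁻¹ : K ℚ_[l] d) * ((c : K ℚ_[l] d) * QuadraticAlgebra.omega)).im = 0 at this
      rw [Units.inv_mul_cancel_left, QuadraticAlgebra.omega_im] at this
      exact one_ne_zero this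
    obtain ⟨v, hv, hv0, hmax⟩ := exists_max_norm_apply hL hf
    refine ⟨(↑c⁻¹ : K ℚ_[l] d) * v, by rwa [hM, Units.mul_inv_cancel_left], hv0, fun w hw => ?_⟩
    have := hmax _ hw
    change ‖((↑c⁻¹ : K ℚ_[l] d) * ((c : K ℚ_[l] d) * w)).im‖ ≤ _ at this
    rwa [Units.inv_mul_cancel_left] at this
  have hsmul {r : ℚ_[l]} (hr : ‖r‖ ≤ 1) {v} (hv : v ∈ M) : r • v ∈ M :=
    smul_mem_of_norm_le_one hr hv
  -- Subtracting the multiple of `τ` with the same imaginary part leaves a scalar in `M`; its norm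
  -- is its square, so the scalar is integral.
  have hform {v} (hv : v ∈ M) : ∃ s r : ℚ_[l], ‖s‖ ≤ 1 ∧ ‖r‖ ≤ 1 ∧ v = s • 1 + r • τ := by
    have hr : ‖v.im / τ.im‖ ≤ 1 := by
      rw [norm_div]
      exact div_le_one_of_le₀ (hτmax v hv) (norm_nonneg _)
    have hw := hN (M.sub_mem hv (hsmul hr hτ))
    have him : (v - (v.im / τ.im) • τ).im = 0 := by
      simp [hτ0]
    rw [norm_K, him] at hw
    refine ⟨(v - (v.im / τ.im) • τ).re, v.im / τ.im, ?_, hr, ?_⟩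
    · simpa [norm_pow, sq_le_one_iff_abs_le_one] using hw
    · ext
      · simp [QuadraticAlgebra.re_one]
      · simp [QuadraticAlgebra.im_one, hτ0]
  have hmul {v w} (hv : v ∈ M) (hw : w ∈ M) : v * w ∈ M := by
    obtain ⟨s, r, hs, hr, rfl⟩ := hform hv
    obtain ⟨s', r', hs', hr', rfl⟩ := hform hw
    -- Trace and norm of `τ` are integral, so its quadratic equation makes the span of `1` and `τ`
    -- closed under multiplication.
    have hττ : τ * τ = (2 * τ.re) • τ - QuadraticAlgebra.norm τ • 1 := by
      rw [norm_K]
      ext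
      · simp [QuadraticAlgebra.re_one]
        ring
      · simp [QuadraticAlgebra.im_one]
        ring
    have h : (s • 1 + r • τ) * (s' • 1 + r' • τ) =
        s • (s' • 1 + r' • τ) + r • (s' • τ + r' • (τ * τ)) := by
      simp only [add_mul, mul_add, smul_mul_assoc, mul_smul_comm, one_mul, mul_one, smul_add,
        smul_comm s' s, smul_comm s' r, smul_comm r' s, smul_comm r' r]
      abel
    rw [h, hττ]
    exact M.add_mem (hsmul hs hw) (hsmul hr (M.add_mem (hsmul hs' hτ)
      (hsmul hr' (M.sub_mem (hsmul (htr hτ) hτ) (hsmul (hN hτ) h1)))))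
  refine ⟨c, fun v => ?_⟩
  have hMS (x) : x ∈ M ↔ x ∈ S := by
    rw [hS]
    refine ⟨fun hx v hv => ?_, fun hx => ?_⟩
    · have := hmul hx ((hM ((↑c⁻¹ : K ℚ_[l] d) * v)).2 (by rwa [Units.mul_inv_cancel_left]))
      rwa [hM, mul_left_comm, Units.mul_inv_cancel_left] at this
    · rw [hM, mul_comm]
      exact hx _ hα
  rw [← hMS, hM, Units.mul_inv_cancel_left]

end Multiplier

/-! ### Conjugation of orders by `K_ℓˣ` -/

section Conjugation

variable {F : Type} [Field F] {d p : ℕ}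

/-- The conjugation by an element of `F(√-d)ˣ` on the quaternion algebra. -/
def conjEquiv (c : (K F d)ˣ) : B F d p ≃ₐ[F] B F d p :=
  AlgEquiv.ofAlgHom
    { toFun x := toB F d p c * x * toB F d p (↑c⁻¹ : K F d)
      map_one' := by rw [mul_one, ← map_mul, Units.mul_inv, map_one]
      map_mul' x y := by
        have h : toB F d p (↑c⁻¹ : K F d) * toB F d p c = 1 := by
          rw [← map_mul, Units.inv_mul, map_one]
        calc toB F d p c * (x * y) * toB F d p (↑c⁻¹ : K F d)
            = toB F d p c * x * 1 * y * toB F d p (↑c⁻¹ : K F d) := by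
              simp only [mul_one, mul_assoc]
          _ = _ := by
              rw [← h]
              simp only [mul_assoc]
      map_zero' := by rw [mul_zero, zero_mul]
      map_add' x y := by rw [mul_add, add_mul]
      commutes' r := by
        rw [← Algebra.commutes, mul_assoc, ← map_mul, Units.mul_inv, map_one, mul_one] }
    { toFun x := toB F d p (↑c⁻¹ : K F d) * x * toB F d p c
      map_one' := by rw [mul_one, ← map_mul, Units.inv_mul, map_one]
      map_mul' x y := by
        have h : toB F d p c * toB F d p (↑c⁻¹ : K F d) = 1 := by
          rw [← map_mul, Units.mul_inv, map_one]
        calc toB F d p (↑c⁻¹ : K F d) * (x * y) * toB F d p c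
            = toB F d p (↑c⁻¹ : K F d) * x * 1 * y * toB F d p c := by
              simp only [mul_one, mul_assoc]
          _ = _ := by
              rw [← h]
              simp only [mul_assoc]
      map_zero' := by rw [mul_zero, zero_mul]
      map_add' x y := by rw [mul_add, add_mul]
      commutes' r := by
        rw [← Algebra.commutes, mul_assoc, ← map_mul, Units.inv_mul, map_one, mul_one] }
    (by
      refine AlgHom.ext fun x => ?_
      change toB F d p c * (toB F d p (↑c⁻¹ : K F d) * x * toB F d p c) *
        toB F d p (↑c⁻¹ : K F d) = x
      rw [← mul_assoc, ← mul_assoc, ← map_mul, mul_assoc, ← map_mul, Units.mul_inv, map_one,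
        one_mul, mul_one])
    (by
      refine AlgHom.ext fun x => ?_
      change toB F d p (↑c⁻¹ : K F d) * (toB F d p c * x * toB F d p (↑c⁻¹ : K F d)) *
        toB F d p c = x
      rw [← mul_assoc, ← mul_assoc, ← map_mul, mul_assoc, ← map_mul, Units.inv_mul, map_one,
        one_mul, mul_one])

theorem jElt_comm (x : K F d) :
    toB F d p x * ⟨0, 0, 1, 0⟩ = (⟨0, 0, 1, 0⟩ : B F d p) * toB F d p (star x) := by
  ext <;> simp [toB]

variable {R : Type} [CommRing R] [Algebra R F]

/-- The conjugate `c S c⁻¹` of a subalgebra. -/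
def conjOrder (c : (K F d)ˣ) (S : Subalgebra R (B F d p)) : Subalgebra R (B F d p) :=
  S.comap (((conjEquiv (p := p) c).symm : B F d p →ₐ[F] B F d p).restrictScalars R)

theorem mem_conjOrder {c : (K F d)ˣ} {S : Subalgebra R (B F d p)} {x : B F d p} :
    x ∈ conjOrder c S ↔ toB F d p (↑c⁻¹ : K F d) * x * toB F d p c ∈ S := Iff.rfl

theorem coe_conjOrder (c : (K F d)ˣ) (S : Subalgebra R (B F d p)) :
    (conjOrder c S : Set (B F d p)) =
      (fun x => toB F d p c * x * toB F d p (↑c⁻¹ : K F d)) '' (S : Set (B F d p)) := by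
  ext x
  constructor
  · intro hx
    exact ⟨_, hx, (conjEquiv c).apply_symm_apply x⟩
  · rintro ⟨y, hy, rfl⟩
    have h : (conjEquiv c).symm (conjEquiv c y) ∈ S := by
      rwa [(conjEquiv c).symm_apply_apply]
    exact h

theorem conjOrder_one (S : Subalgebra R (B F d p)) : conjOrder 1 S = S := by
  ext x
  rw [mem_conjOrder, inv_one, Units.val_one, map_one, one_mul, mul_one]

theorem conjOrder_mul (c c' : (K F d)ˣ) (S : Subalgebra R (B F d p)) :
    conjOrder (c * c') S = conjOrder c (conjOrder c' S) := by
  ext x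
  rw [mem_conjOrder, mem_conjOrder, mem_conjOrder, mul_inv_rev, Units.val_mul, Units.val_mul,
    map_mul, map_mul]
  simp only [mul_assoc]

/-- The hypothesis `h` encodes `L' = c L`; since `K_ℓ` acts by multiplication, conjugating by `c`
translates the lattice by `c`. -/
theorem conjOrder_stabilizer [CharZero F] (hd : 0 < d) (hp : p ≠ 0) {a : K F d}
    (ha : a * star a = -(p : K F d)) (c : (K F d)ˣ) {L L' : Submodule R (K F d)}
    (h : ∀ v, v ∈ L' ↔ (↑c⁻¹ : K F d) * v ∈ L) :
    conjOrder c (stabilizer (actionEquiv hd hp a ha) L) =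
      stabilizer (actionEquiv hd hp a ha) L' := by
  ext x
  rw [mem_conjOrder, mem_stabilizer, mem_stabilizer]
  simp only [map_mul, Module.End.mul_apply, actionEquiv_toB]
  constructor
  · intro hx v hv
    have := hx _ ((h v).1 hv)
    rwa [Units.mul_inv_cancel_left, ← h] at this
  · intro hx v hv
    rw [← h]
    exact hx _ ((h _).2 (by rwa [Units.inv_mul_cancel_left]))

end Conjugation

/-! ### The completion of `O` -/

section Completion

variable {l : ℕ} [Fact l.Prime] {d : ℕ} {O : Subalgebra ℤ (K ℚ d)}

/-- The nontrivial automorphism of `K`. -/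
def conjK (d : ℕ) : K ℚ d ≃ₐ[ℚ] K ℚ d :=
  AlgEquiv.ofAlgHom
    { starRingEnd (K ℚ d) with
      commutes' r := by
        change star _ = _
        ext <;> simp [QuadraticAlgebra.algebraMap_eq] }
    { starRingEnd (K ℚ d) with
      commutes' r := by
        change star _ = _
        ext <;> simp [QuadraticAlgebra.algebraMap_eq] }
    (AlgHom.ext fun x => star_star x) (AlgHom.ext fun x => star_star x)

theorem galAt_conjK (F : Type) [Field F] [CharZero F] (x : K F d) :
    galAt F (conjK d) x = star x := by
  have h : conjK d QuadraticAlgebra.omega = star QuadraticAlgebra.omega := rfl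
  rw [galAt_apply, h]
  ext <;> simp [baseK, QuadraticAlgebra.re_one, QuadraticAlgebra.im_one]

theorem eq_one_or_eq_conjK (hd : 0 < d) (s : K ℚ d ≃ₐ[ℚ] K ℚ d) : s = 1 ∨ s = conjK d := by
  have := noZeroDivisors_K hd
  have hω : (QuadraticAlgebra.omega : K ℚ d) * QuadraticAlgebra.omega =
      algebraMap ℚ (K ℚ d) (-(d : ℚ)) := by
    rw [QuadraticAlgebra.omega_mul_omega_eq_mk]
    rfl
  have h0 : s QuadraticAlgebra.omega * s QuadraticAlgebra.omega =
      (QuadraticAlgebra.omega : K ℚ d) * QuadraticAlgebra.omega := by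
    rw [← map_mul, hω, AlgEquiv.commutes]
  have hext {t : K ℚ d ≃ₐ[ℚ] K ℚ d} (h : s QuadraticAlgebra.omega = t QuadraticAlgebra.omega) :
      s = t :=
    AlgEquiv.coe_toAlgHom_injective (QuadraticAlgebra.algHom_ext h)
  rcases mul_self_eq_mul_self_iff.1 h0 with h | h
  · exact Or.inl (hext h)
  · refine Or.inr (hext (h.trans ?_))
    have h' : conjK d QuadraticAlgebra.omega = star QuadraticAlgebra.omega := rfl
    rw [h']
    ext <;> simp

theorem star_mem_OAt (hd : 0 < d) (hO : IsOrder ℤ ℚ O) {x : K ℚ_[l] d} (hx : x ∈ OAt l O) :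
    star x ∈ OAt l O := by
  rw [← galAt_conjK]
  exact galAt_mem hd hO l _ hx

theorem isLattice_OAt (hO : IsOrder ℤ ℚ O) :
    Submodule.IsLattice ℚ_[l] (Subalgebra.toSubmodule (OAt l O)) where
  fg := by
    classical
    obtain ⟨s, hs⟩ := hO.fg
    rw [toSubmodule_OAt]
    refine ⟨s.image (baseK ℚ_[l] d), le_antisymm (Submodule.span_mono ?_) ?_⟩
    · rw [Finset.coe_image]
      refine Set.image_mono ?_
      have := Submodule.subset_span (R := ℤ) (s := (s : Set (K ℚ d)))
      rwa [hs] at this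
    · rw [Submodule.span_le, Finset.coe_image]
      rintro _ ⟨x, hx, rfl⟩
      have hx' : x ∈ Submodule.span ℤ (s : Set (K ℚ d)) := by rwa [hs]
      clear hx
      induction hx' using Submodule.span_induction with
      | mem y hy => exact Submodule.subset_span ⟨y, hy, rfl⟩
      | zero => simp
      | add y z _ _ hy hz =>
        rw [map_add]
        exact Submodule.add_mem _ hy hz
      | smul n y _ hy =>
        rw [map_zsmul]
        exact zsmul_mem hy n
  span_eq_top := by
    refine eq_top_iff.2 fun x _ => ?_
    have hmem (y : K ℚ d) : baseK ℚ_[l] d y ∈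
        Submodule.span ℚ_[l] (Subalgebra.toSubmodule (OAt l O) : Set (K ℚ_[l] d)) := by
      obtain ⟨n, hn, hy⟩ := exists_smul_mem (R := ℤ) (F := ℚ) hO y
      have h : baseK ℚ_[l] d y = (n : ℚ_[l])⁻¹ • baseK ℚ_[l] d (n • y) := by
        have hn' : (n : ℚ_[l]) ≠ 0 := by exact_mod_cast hn
        rw [map_zsmul, ← Int.cast_smul_eq_zsmul ℚ_[l], smul_smul, inv_mul_cancel₀ hn', one_smul]
      rw [h]
      exact Submodule.smul_mem _ _ (Submodule.subset_span (Algebra.subset_adjoin ⟨_, hy, rfl⟩))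
    have hx : x = x.re • baseK ℚ_[l] d 1 + x.im • baseK ℚ_[l] d QuadraticAlgebra.omega := by
      ext <;> simp [baseK, QuadraticAlgebra.re_one, QuadraticAlgebra.im_one]
    rw [hx]
    exact Submodule.add_mem _ (Submodule.smul_mem _ _ (hmem _)) (Submodule.smul_mem _ _ (hmem _))

end Completion

/-! ### The set of optimal maximal orders -/

section Optimal

variable {l : ℕ} [Fact l.Prime] {d p : ℕ} {O : Subalgebra ℤ (K ℚ d)}

/-- The ring `R` already contains `O_ℓ`, so of `O + j O` only the generator `j` remains to be
tested. -/
theorem LamAt_le_iff {R : Subalgebra ℤ_[l] (B ℚ_[l] d p)}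
    (hR : R.comap ((toB ℚ_[l] d p).restrictScalars ℤ_[l]) = OAt l O) :
    LamAt l p O ≤ Subalgebra.toSubmodule R ↔ (⟨0, 0, 1, 0⟩ : B ℚ_[l] d p) ∈ R := by
  have hj : baseB ℚ_[l] d p (jElt d p) = ⟨0, 0, 1, 0⟩ := by
    ext <;> simp [baseB, jElt]
  have htoB (x : K ℚ d) : baseB ℚ_[l] d p (toB ℚ d p x) = toB ℚ_[l] d p (baseK ℚ_[l] d x) := by
    ext <;> simp [baseB, baseK, toB]
  constructor
  · intro h
    refine h (Submodule.subset_span ⟨jElt d p, ?_, hj⟩)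
    refine Submodule.mem_sup_right ⟨1, O.one_mem, ?_⟩
    change jElt d p * toB ℚ d p 1 = _
    rw [map_one, mul_one]
  · intro h
    refine Submodule.span_le.2 ?_
    rintro _ ⟨x, hx, rfl⟩
    obtain ⟨_, ⟨y, hy, rfl⟩, _, ⟨z, hz, rfl⟩, rfl⟩ := Submodule.mem_sup.1 hx
    have hmem {y : K ℚ d} (hy : y ∈ O) : toB ℚ_[l] d p (baseK ℚ_[l] d y) ∈ R := by
      have : baseK ℚ_[l] d y ∈ OAt l O := Algebra.subset_adjoin ⟨y, hy, rfl⟩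
      rwa [← hR] at this
    change baseB ℚ_[l] d p (toB ℚ d p y + jElt d p * toB ℚ d p z) ∈ R
    rw [map_add, map_mul, hj, htoB, htoB]
    exact R.add_mem (hmem hy) (R.mul_mem h (hmem hz))

theorem mem_SOpt_iff {R : Subalgebra ℤ_[l] (B ℚ_[l] d p)} :
    R ∈ SOpt l p O ↔ Maximal (IsOrder ℤ_[l] ℚ_[l]) R ∧ (⟨0, 0, 1, 0⟩ : B ℚ_[l] d p) ∈ R ∧
      ∀ x, toB ℚ_[l] d p x ∈ R ↔ x ∈ OAt l O := by
  have h : (R.comap ((toB ℚ_[l] d p).restrictScalars ℤ_[l]) = OAt l O) ↔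
      ∀ x, toB ℚ_[l] d p x ∈ R ↔ x ∈ OAt l O := SetLike.ext_iff
  rw [← h]
  constructor
  · rintro ⟨h1, h2, h3⟩
    exact ⟨h1, (LamAt_le_iff h3).1 h2, h3⟩
  · rintro ⟨h1, h2, h3⟩
    exact ⟨h1, (LamAt_le_iff h3).2 h2, h3⟩

/-- Conjugation by `c` fixes the commutative `K_ℓ` pointwise, and `c⁻¹ j c = j (star c⁻¹ * c)`. -/
theorem conjOrder_mem_SOpt {R : Subalgebra ℤ_[l] (B ℚ_[l] d p)} (hR : R ∈ SOpt l p O)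
    {c : (K ℚ_[l] d)ˣ} (hc : star (↑c⁻¹ : K ℚ_[l] d) * c ∈ OAt l O) :
    conjOrder c R ∈ SOpt l p O := by
  rw [mem_SOpt_iff] at hR ⊢
  obtain ⟨hmax, hj, hK⟩ := hR
  refine ⟨maximal_isOrder_comap hmax _, ?_, fun x => ?_⟩
  · rw [mem_conjOrder, jElt_comm, mul_assoc, ← map_mul]
    exact R.mul_mem hj ((hK _).2 hc)
  · rw [mem_conjOrder, ← map_mul, ← map_mul, mul_right_comm, Units.inv_mul, one_mul, hK]

theorem stabilizer_mem_SOpt (hd : 0 < d) (hp : p ≠ 0) {a : K ℚ_[l] d}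
    (ha : a * star a = -(p : K ℚ_[l] d))
    (hO : IsOrder ℤ ℚ O) (haO : a ∈ OAt l O) :
    stabilizer (actionEquiv hd hp a ha) (Subalgebra.toSubmodule (OAt l O)) ∈ SOpt l p O := by
  refine mem_SOpt_iff.2 ⟨maximal_stabilizer _ (isLattice_OAt hO), fun v hv => ?_, fun x => ?_⟩
  · have h0 : (⟨0, 0⟩ : K ℚ_[l] d) = 0 := rfl
    have h1 : (⟨1, 0⟩ : K ℚ_[l] d) = 1 := rfl
    rw [actionEquiv_apply, h0, h1, zero_mul, zero_add, one_mul]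
    exact (OAt l O).mul_mem haO (star_mem_OAt hd hO hv)
  · rw [mem_stabilizer]
    simp only [actionEquiv_toB]
    refine ⟨fun h => ?_, fun h v hv => (OAt l O).mul_mem h hv⟩
    have := h 1 (OAt l O).one_mem
    rwa [mul_one] at this

/-- Optimality says that the lattice of `R` has multiplier ring `O_ℓ`, so it is `c O_ℓ`; the
membership condition records that `j` sends `c` into this lattice. The model stabilizer of `O_ℓ`
need not itself be optimal. -/
theorem exists_eq_conjOrder_stabilizer (hd : 0 < d) (hp : p ≠ 0) {a : K ℚ_[l] d}
    (ha : a * star a = -(p : K ℚ_[l] d))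
    {R : Subalgebra ℤ_[l] (B ℚ_[l] d p)}
    (hR : R ∈ SOpt l p O) :
    ∃ c : (K ℚ_[l] d)ˣ, (↑c⁻¹ : K ℚ_[l] d) * (a * star (c : K ℚ_[l] d)) ∈ OAt l O ∧
      R = conjOrder c
        (stabilizer (actionEquiv hd hp a ha) (Subalgebra.toSubmodule (OAt l O))) := by
  obtain ⟨hmax, hj, hK⟩ := mem_SOpt_iff.1 hR
  obtain ⟨L, hL, rfl⟩ := exists_eq_stabilizer (actionEquiv hd hp a ha) hmax
  obtain ⟨c, hc⟩ := exists_eq_mul_of_multiplier_eq hL (S := OAt l O) (fun x => by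
    rw [← hK, mem_stabilizer]
    simp only [actionEquiv_toB])
  refine ⟨c, ?_, (conjOrder_stabilizer hd hp ha c hc).symm⟩
  have h := hj c ((hc c).2 (by rw [Units.inv_mul]; exact (OAt l O).one_mem))
  have h0 : (⟨0, 0⟩ : K ℚ_[l] d) = 0 := rfl
  have h1 : (⟨1, 0⟩ : K ℚ_[l] d) = 1 := rfl
  rwa [actionEquiv_apply, h0, h1, zero_mul, zero_add, one_mul, hc] at h

theorem conjOrder_eq_self_iff (hd : 0 < d) (hp : p ≠ 0) {a : K ℚ_[l] d}
    (ha : a * star a = -(p : K ℚ_[l] d))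
    (hO : IsOrder ℤ ℚ O) {R : Subalgebra ℤ_[l] (B ℚ_[l] d p)}
    (hR : R ∈ SOpt l p O) (c : (K ℚ_[l] d)ˣ) :
    conjOrder c R = R ↔
      ∃ (r : ℚ_[l]) (v : (OAt l O)ˣ), (c : K ℚ_[l] d) = r • ((v : OAt l O) : K ℚ_[l] d) := by
  constructor
  · intro h
    obtain ⟨c₀, -, rfl⟩ := exists_eq_conjOrder_stabilizer hd hp ha hR
    -- Because `K_ℓˣ` is commutative, `c₀` drops out and only the stabilizer of `O_ℓ` matters.
    have h' := congrArg (conjOrder c₀⁻¹) h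
    rw [← conjOrder_mul, ← conjOrder_mul, ← conjOrder_mul, inv_mul_cancel, conjOrder_one,
      mul_right_comm, inv_mul_cancel, one_mul] at h'
    have hlat := IsLattice.map (R := ℤ_[l]) (isLattice_OAt (l := l) hO)
      (f := LinearMap.mulLeft ℚ_[l] (c : K ℚ_[l] d))
      (fun x => ⟨(↑c⁻¹ : K ℚ_[l] d) * x, Units.mul_inv_cancel_left _ _⟩)
    have hmem (v : K ℚ_[l] d) : v ∈ (Subalgebra.toSubmodule (OAt l O)).map
        ((LinearMap.mulLeft ℚ_[l] (c : K ℚ_[l] d)).restrictScalars ℤ_[l]) ↔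
        (↑c⁻¹ : K ℚ_[l] d) * v ∈ Subalgebra.toSubmodule (OAt l O) := by
      constructor
      · rintro ⟨w, hw, rfl⟩
        change (↑c⁻¹ : K ℚ_[l] d) * (c * w) ∈ _
        rwa [Units.inv_mul_cancel_left]
      · intro hv
        exact ⟨_, hv, Units.mul_inv_cancel_left _ _⟩
    rw [conjOrder_stabilizer hd hp ha c hmem] at h'
    obtain ⟨r, hr, hrmem⟩ := exists_homothety_of_stabilizer_eq _ (isLattice_OAt hO) hlat h'.symm
    simp only [hmem, mul_smul_comm, Subalgebra.mem_toSubmodule] at hrmem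
    -- The homothety says `r O_ℓ = c O_ℓ`. Testing it on `1` and `r⁻¹ c` gives the mutually inverse
    -- elements `r c⁻¹` and `r⁻¹ c` of `O_ℓ`.
    have h1 := (hrmem 1).1 (OAt l O).one_mem
    have h2 := (hrmem (r⁻¹ • (c : K ℚ_[l] d))).2 (by
      rw [mul_smul_comm, Units.inv_mul, smul_smul, mul_inv_cancel₀ hr, one_smul]
      exact (OAt l O).one_mem)
    rw [mul_one] at h1
    refine ⟨r, ⟨⟨_, h2⟩, ⟨_, h1⟩, Subtype.ext ?_, Subtype.ext ?_⟩, ?_⟩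
    · change (r⁻¹ • (c : K ℚ_[l] d)) * (r • (↑c⁻¹ : K ℚ_[l] d)) = 1
      rw [smul_mul_smul_comm, Units.mul_inv, inv_mul_cancel₀ hr, one_smul]
    · change (r • (↑c⁻¹ : K ℚ_[l] d)) * (r⁻¹ • (c : K ℚ_[l] d)) = 1
      rw [smul_mul_smul_comm, Units.inv_mul, mul_inv_cancel₀ hr, one_smul]
    · change (c : K ℚ_[l] d) = r • r⁻¹ • (c : K ℚ_[l] d)
      rw [smul_smul, mul_inv_cancel₀ hr, one_smul]
  · rintro ⟨r, v, hv⟩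
    obtain ⟨hmax, hj, hK⟩ := mem_SOpt_iff.1 hR
    have hr : r ≠ 0 := by
      rintro rfl
      rw [zero_smul] at hv
      exact c.ne_zero hv
    have hv1 : ((v : OAt l O) : K ℚ_[l] d) * ((↑v⁻¹ : OAt l O) : K ℚ_[l] d) = 1 := by
      rw [← MulMemClass.coe_mul, Units.mul_inv, OneMemClass.coe_one]
    have hcinv : (↑c⁻¹ : K ℚ_[l] d) = r⁻¹ • ((↑v⁻¹ : OAt l O) : K ℚ_[l] d) := by
      rw [Units.inv_eq_of_mul_eq_one_right]
      rw [hv, smul_mul_smul_comm, hv1, mul_inv_cancel₀ hr, one_smul]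
    have hvR (w : OAt l O) : toB ℚ_[l] d p w ∈ R := (hK _).2 w.2
    have hconj (x : B ℚ_[l] d p) : toB ℚ_[l] d p (↑c⁻¹ : K ℚ_[l] d) * x * toB ℚ_[l] d p c =
        toB ℚ_[l] d p (↑v⁻¹ : OAt l O) * x * toB ℚ_[l] d p (v : OAt l O) := by
      rw [hcinv, hv, map_smul, map_smul, smul_mul_assoc, smul_mul_smul_comm, inv_mul_cancel₀ hr,
        one_smul]
    ext x
    rw [mem_conjOrder, hconj]
    refine ⟨fun hx => ?_, fun hx => R.mul_mem (R.mul_mem (hvR _) hx) (hvR _)⟩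
    have h := R.mul_mem (R.mul_mem (hvR v) hx) (hvR ↑v⁻¹)
    have hx' : toB ℚ_[l] d p (v : OAt l O) * (toB ℚ_[l] d p (↑v⁻¹ : OAt l O) * x *
        toB ℚ_[l] d p (v : OAt l O)) * toB ℚ_[l] d p (↑v⁻¹ : OAt l O) = x := by
      rw [← mul_assoc, ← mul_assoc, ← map_mul, mul_assoc, ← map_mul, hv1, map_one, one_mul,
        mul_one]
    rwa [hx'] at h

theorem SOpt_nonempty_iff (hd : 0 < d) (hp : p ≠ 0) (hO : IsOrder ℤ ℚ O) (hpl : ‖(p : ℚ_[l])‖ = 1)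
    (hsplit : Nonempty (B ℚ_[l] d p ≃ₐ[ℚ_[l]] Matrix (Fin 2) (Fin 2) ℚ_[l])) :
    (SOpt l p O).Nonempty ↔
      ∃ u : (OAt l O)ˣ, ((u : OAt l O) : K ℚ_[l] d) * star ((u : OAt l O) : K ℚ_[l] d) =
        -(p : K ℚ_[l] d) := by
  constructor
  · rintro ⟨R, hR⟩
    obtain ⟨a, ha⟩ := exists_mul_star_eq_of_split hd hsplit
    obtain ⟨c, hc, -⟩ := exists_eq_conjOrder_stabilizer hd hp ha hR
    set u : K ℚ_[l] d := (↑c⁻¹ : K ℚ_[l] d) * (a * star (c : K ℚ_[l] d)) with hu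
    have hN : u * star u = -(p : K ℚ_[l] d) := by
      have hc1 := Units.inv_mul c
      have hc2 : star (↑c⁻¹ : K ℚ_[l] d) * star (c : K ℚ_[l] d) = 1 := by
        rw [← star_mul', hc1, star_one]
      rw [hu, star_mul', star_mul', star_star]
      linear_combination (a * star a * star (↑c⁻¹ : K ℚ_[l] d) * star (c : K ℚ_[l] d)) * hc1 +
        a * star a * hc2 + ha
    have hp0 : (p : ℚ_[l]) ≠ 0 := by exact_mod_cast hp
    -- The inverse of `u` is `star u / (-p)`; it stays in `O_ℓ` because `p` is an `l`-adic unit.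
    have hinv : (-(p : ℚ_[l])⁻¹) • star u ∈ OAt l O := by
      refine smul_mem_of_norm_le_one (L := Subalgebra.toSubmodule (OAt l O)) ?_
        (star_mem_OAt hd hO hc)
      rw [norm_neg, norm_inv, hpl, inv_one]
    have hmul : u * ((-(p : ℚ_[l])⁻¹) • star u) = 1 := by
      rw [mul_smul_comm, hN]
      ext <;> simp [QuadraticAlgebra.re_one, QuadraticAlgebra.im_one, hp0]
    refine ⟨⟨⟨u, hc⟩, ⟨_, hinv⟩, Subtype.ext hmul, Subtype.ext ?_⟩, hN⟩
    exact (mul_comm _ _).trans hmul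
  · rintro ⟨u, hu⟩
    exact ⟨_, stabilizer_mem_SOpt hd hp hu hO u.1.2⟩

end Optimal

/-- The trace form is nondegenerate: a nonzero integral `x` divides a nonzero integer `n`, whose
trace is `2 n`. This turns `l ∣ disc O` into `l ≤ |disc O|`. -/
theorem disc_ne_zero {d : ℕ} (hd : 0 < d) {O : Subalgebra ℤ (K ℚ d)} (hO : IsOrder ℤ ℚ O) :
    disc O ≠ 0 := by
  obtain ⟨b⟩ := nonempty_basis O hO
  have := noZeroDivisors_K hd
  have : IsDomain (K ℚ d) := NoZeroDivisors.to_isDomain _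
  have hfree : Module.Free ℤ O := Module.Free.of_basis b
  have hrank : Module.finrank ℤ O = 2 := by
    rw [Module.finrank_eq_card_basis b, Fintype.card_fin]
  rw [disc_eq O b, Algebra.discr_def, Algebra.traceMatrix_of_basis,
    ← LinearMap.BilinForm.nondegenerate_iff_det_ne_zero]
  have hsymm : (Algebra.traceForm ℤ O).IsSymm := Algebra.traceForm_isSymm ℤ
  refine hsymm.isRefl.nondegenerate_iff_separatingLeft.2 fun x hx => ?_
  by_contra hx0
  have hint : IsIntegral ℤ x := by
    have h := IsIntegral.of_mem_of_fg O hO.fg x x.2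
    exact (isIntegral_algHom_iff O.val Subtype.val_injective).1 h
  obtain ⟨n, hn, y, hy⟩ := hint.isAlgebraic.exists_nonzero_dvd
    (mem_nonZeroDivisors_of_ne_zero hx0)
  have h := hx y
  rw [Algebra.traceForm_apply, ← hy, Algebra.trace_algebraMap, hrank] at h
  simp [hn] at h

/-! ### Cocycles with values in `O_ℓˣ` -/

section Cocycle

variable {d : ℕ} (hd : 0 < d) {O : Subalgebra ℤ (K ℚ d)} (hO : IsOrder ℤ ℚ O)
  {l : ℕ} [Fact l.Prime]

open groupCohomology

/-- The cocycle `z` becomes the coboundary of `c` over `K_ℓˣ`. -/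
def IsTrivializedBy (z : cocycles₁ (unitsRep hd hO l)) (c : (K ℚ_[l] d)ˣ) : Prop :=
  ∀ s : K ℚ d ≃ₐ[ℚ] K ℚ d, galAt ℚ_[l] s c = cocycleValue hd hO l z s * c

variable {hd hO}

theorem cocycleValue_zero (s : K ℚ d ≃ₐ[ℚ] K ℚ d) :
    cocycleValue hd hO l (0 : cocycles₁ (unitsRep hd hO l)) s = 1 := rfl

theorem cocycleValue_add (z z' : cocycles₁ (unitsRep hd hO l)) (s : K ℚ d ≃ₐ[ℚ] K ℚ d) :
    cocycleValue hd hO l (z + z') s = cocycleValue hd hO l z s * cocycleValue hd hO l z' s := rfl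

theorem cocycleValue_mem (z : cocycles₁ (unitsRep hd hO l)) (s : K ℚ d ≃ₐ[ℚ] K ℚ d) :
    cocycleValue hd hO l z s ∈ OAt l O := Subtype.prop _

theorem cocycleValue_mul (z : cocycles₁ (unitsRep hd hO l)) (s t : K ℚ d ≃ₐ[ℚ] K ℚ d) :
    cocycleValue hd hO l z (s * t) =
      galAt ℚ_[l] s (cocycleValue hd hO l z t) * cocycleValue hd hO l z s := by
  have h := (mem_cocycles₁_iff (A := unitsRep hd hO l) z).1 z.2 s t
  exact congrArg (fun u : Additive (OAt l O)ˣ => ((u.toMul : OAt l O) : K ℚ_[l] d)) h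

theorem cocycleValue_one (z : cocycles₁ (unitsRep hd hO l)) :
    cocycleValue hd hO l z 1 = 1 := by
  have h := cocycles₁_map_one (A := unitsRep hd hO l) z
  exact congrArg (fun u : Additive (OAt l O)ˣ => ((u.toMul : OAt l O) : K ℚ_[l] d)) h

theorem IsTrivializedBy.add {z z' : cocycles₁ (unitsRep hd hO l)} {c c' : (K ℚ_[l] d)ˣ}
    (h : IsTrivializedBy hd hO z c) (h' : IsTrivializedBy hd hO z' c') :
    IsTrivializedBy hd hO (z + z') (c * c') := by
  intro s
  rw [cocycleValue_add, Units.val_mul, map_mul, h s, h' s]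
  ring

theorem isTrivializedBy_zero_one :
    IsTrivializedBy hd hO (0 : cocycles₁ (unitsRep hd hO l)) 1 := by
  intro s
  rw [cocycleValue_zero, Units.val_one, map_one, mul_one]

theorem IsTrivializedBy.sub {z z' : cocycles₁ (unitsRep hd hO l)} {c c' : (K ℚ_[l] d)ˣ}
    (h : IsTrivializedBy hd hO z c) (h' : IsTrivializedBy hd hO z' c') :
    IsTrivializedBy hd hO (z - z') (c * c'⁻¹) := by
  intro s
  have h1 := cocycleValue_add (z - z') z' s
  have h0 : z - z' + z' = z := sub_add_cancel z z'
  rw [h0] at h1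
  have h2 := h s
  rw [h1] at h2
  have h3 : galAt ℚ_[l] s c' * galAt ℚ_[l] s (↑c'⁻¹ : K ℚ_[l] d) = 1 := by
    rw [← map_mul, Units.mul_inv, map_one]
  have h4 := Units.mul_inv c'
  rw [Units.val_mul, map_mul]
  rw [h' s] at h3
  linear_combination galAt ℚ_[l] s (↑c'⁻¹ : K ℚ_[l] d) * h2 -
    cocycleValue hd hO l (z - z') s * c * galAt ℚ_[l] s (↑c'⁻¹ : K ℚ_[l] d) *
      cocycleValue hd hO l z' s * h4 +
    cocycleValue hd hO l (z - z') s * c * (↑c'⁻¹ : K ℚ_[l] d) * h3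

/-- The Galois group has order 2, so `z` is determined by its value `u` at conjugation; the cocycle
identity reads `u * star u = 1`, and Hilbert 90 applies. -/
theorem exists_isTrivializedBy (z : cocycles₁ (unitsRep hd hO l)) :
    ∃ c, IsTrivializedBy hd hO z c := by
  have hσ : conjK d * conjK d = 1 := AlgEquiv.ext fun x => star_star x
  have h := cocycleValue_mul z (conjK d) (conjK d)
  rw [hσ, cocycleValue_one, galAt_conjK, mul_comm] at h
  obtain ⟨c, hc⟩ := exists_star_eq_mul hd h.symm
  refine ⟨c, fun s => ?_⟩
  rcases eq_one_or_eq_conjK hd s with rfl | rfl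
  · rw [galAt_one, cocycleValue_one, one_mul]
  · rw [galAt_conjK, hc]

theorem IsTrivializedBy.star_inv_mul_mem {z : cocycles₁ (unitsRep hd hO l)} {c : (K ℚ_[l] d)ˣ}
    (h : IsTrivializedBy hd hO z c) : star (↑c⁻¹ : K ℚ_[l] d) * c ∈ OAt l O := by
  have h1 := h (conjK d)
  rw [galAt_conjK] at h1
  have h2 : star (↑c⁻¹ : K ℚ_[l] d) * c = star (cocycleValue hd hO l z (conjK d)) := by
    have h3 := congrArg star h1
    rw [star_star, star_mul'] at h3
    rw [h3, mul_left_comm, ← star_mul', Units.inv_mul, star_one, mul_one]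
  rw [h2]
  exact star_mem_OAt hd hO (cocycleValue_mem z _)

/-- The element `star c / c` has norm 1, so once in `O_ℓ` it is a unit there with inverse its
conjugate. Thus `s ↦ s(c) / c` is a cocycle with values in `O_ℓˣ`. -/
theorem exists_isTrivializedBy_of_mem (c : (K ℚ_[l] d)ˣ)
    (hc : star (c : K ℚ_[l] d) * (↑c⁻¹ : K ℚ_[l] d) ∈ OAt l O) :
    ∃ z : cocycles₁ (unitsRep hd hO l), IsTrivializedBy hd hO z c := by
  have hv (s : K ℚ d ≃ₐ[ℚ] K ℚ d) :
      ∃ v : (OAt l O)ˣ, galAt ℚ_[l] s c = ((v : OAt l O) : K ℚ_[l] d) * c := by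
    rcases eq_one_or_eq_conjK hd s with rfl | rfl
    · refine ⟨1, ?_⟩
      rw [galAt_one, Units.val_one, OneMemClass.coe_one, one_mul]
    · have hmul : (star (c : K ℚ_[l] d) * (↑c⁻¹ : K ℚ_[l] d)) *
          star (star (c : K ℚ_[l] d) * (↑c⁻¹ : K ℚ_[l] d)) = 1 := by
        have hstar : star (c : K ℚ_[l] d) * star (↑c⁻¹ : K ℚ_[l] d) = 1 := by
          rw [← star_mul', Units.mul_inv, star_one]
        rw [star_mul', star_star]
        linear_combination (c : K ℚ_[l] d) * (↑c⁻¹ : K ℚ_[l] d) * hstar + Units.mul_inv c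
      refine ⟨⟨⟨_, hc⟩, ⟨_, star_mem_OAt hd hO hc⟩, Subtype.ext hmul,
        Subtype.ext ((mul_comm _ _).trans hmul)⟩, ?_⟩
      rw [galAt_conjK]
      exact (Units.inv_mul_cancel_right _ _).symm
  choose v hv using hv
  refine ⟨⟨fun s => Additive.ofMul (v s), (mem_cocycles₁_iff _).2 fun s t => ?_⟩, fun s => hv s⟩
  refine Additive.toMul.injective (Units.ext (Subtype.ext ?_))
  change ((v (s * t) : OAt l O) : K ℚ_[l] d) =
    galAt ℚ_[l] s ((v t : OAt l O) : K ℚ_[l] d) * ((v s : OAt l O) : K ℚ_[l] d)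
  refine c.isUnit.mul_right_cancel ?_
  rw [← hv, galAt_mul, hv t, map_mul, hv s, mul_assoc]

/-- `z` is the coboundary of a unit `v` exactly when `c / v` is Galois-invariant, that is, lies in
`ℚ_ℓ`. The right side matches `conjOrder_eq_self_iff`. -/
theorem IsTrivializedBy.H1π_eq_zero_iff {z : cocycles₁ (unitsRep hd hO l)} {c : (K ℚ_[l] d)ˣ}
    (h : IsTrivializedBy hd hO z c) :
    H1π (unitsRep hd hO l) z = 0 ↔
      ∃ (r : ℚ_[l]) (v : (OAt l O)ˣ), (c : K ℚ_[l] d) = r • ((v : OAt l O) : K ℚ_[l] d) := by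
  rw [groupCohomology.H1π_eq_zero_iff]
  have hcob (v : (OAt l O)ˣ) (s : K ℚ d ≃ₐ[ℚ] K ℚ d) :
      (unitsRepresentation hd hO l s (Additive.ofMul v) - Additive.ofMul v =
        (z s : Additive (OAt l O)ˣ)) ↔
        galAt ℚ_[l] s (v : OAt l O) = cocycleValue hd hO l z s * (v : OAt l O) := by
    rw [sub_eq_iff_eq_add]
    constructor
    · intro h
      exact congrArg
        (fun u : Additive (OAt l O)ˣ => ((u.toMul : OAt l O) : K ℚ_[l] d)) h
    · intro h
      exact Additive.toMul.injective (Units.ext (Subtype.ext h))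
  constructor
  · rintro ⟨v, hv⟩
    have hv' := (hcob (Additive.toMul v) (conjK d)).1 (congrFun hv _)
    have hc := h (conjK d)
    rw [galAt_conjK] at hv' hc
    set v' : (OAt l O)ˣ := Additive.toMul v
    set w : K ℚ_[l] d := ((↑v'⁻¹ : OAt l O) : K ℚ_[l] d) with hw
    have hvw : ((v' : OAt l O) : K ℚ_[l] d) * w = 1 := by
      rw [hw, ← MulMemClass.coe_mul, Units.mul_inv, OneMemClass.coe_one]
    have hsvw : star ((v' : OAt l O) : K ℚ_[l] d) * star w = 1 := by
      rw [← star_mul', hvw, star_one]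
    have hfix : star (c * w : K ℚ_[l] d) = c * w := by
      rw [star_mul', hc]
      rw [hv'] at hsvw
      linear_combination (-(cocycleValue hd hO l z (conjK d)) * c * star w) * hvw + c * w * hsvw
    refine ⟨(c * w : K ℚ_[l] d).re, v', ?_⟩
    have h1 := exists_smul_one_of_star_eq hfix
    have h2 : (c : K ℚ_[l] d) = (c * w) * ((v' : OAt l O) : K ℚ_[l] d) := by
      linear_combination (-c : K ℚ_[l] d) * hvw
    refine (h2.trans (congrArg (· * ((v' : OAt l O) : K ℚ_[l] d)) h1)).trans ?_
    change (c * w : K ℚ_[l] d).re • (1 : K ℚ_[l] d) * ((v' : OAt l O) : K ℚ_[l] d) = _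
    rw [smul_mul_assoc, one_mul]
  · rintro ⟨r, v, hv⟩
    refine ⟨Additive.ofMul v, funext fun s => (hcob v s).2 ?_⟩
    have hr : r ≠ 0 := by
      rintro rfl
      rw [zero_smul] at hv
      exact c.ne_zero hv
    have h1 := h s
    rw [hv, map_smul, mul_smul_comm] at h1
    exact smul_right_injective _ hr h1

end Cocycle

/-! ### The action of the cohomology group -/

section Action

open groupCohomology

variable {d p : ℕ} {O : Subalgebra ℤ (K ℚ d)} {l : ℕ} [Fact l.Prime]

theorem exists_conjOrder_eq (hd : 0 < d) (hp : p ≠ 0) (hO : IsOrder ℤ ℚ O)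
    (hpl : ‖(p : ℚ_[l])‖ = 1) {a : K ℚ_[l] d} (ha : a * star a = -(p : K ℚ_[l] d))
    {R R' : Subalgebra ℤ_[l] (B ℚ_[l] d p)} (hR : R ∈ SOpt l p O) (hR' : R' ∈ SOpt l p O) :
    ∃ c : (K ℚ_[l] d)ˣ, star (c : K ℚ_[l] d) * (↑c⁻¹ : K ℚ_[l] d) ∈ OAt l O ∧
      conjOrder c R = R' := by
  obtain ⟨c, hc, rfl⟩ := exists_eq_conjOrder_stabilizer hd hp ha hR
  obtain ⟨c', hc', rfl⟩ := exists_eq_conjOrder_stabilizer hd hp ha hR'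
  refine ⟨c' * c⁻¹, ?_, by rw [← conjOrder_mul, inv_mul_cancel_right]⟩
  have hp0 : (p : ℚ_[l]) ≠ 0 := by exact_mod_cast hp
  have hmem := (OAt l O).mul_mem hc' (star_mem_OAt hd hO hc)
  -- With `u = c⁻¹ a star c` and `u'` likewise for `c'`, the quotient `star e / e` for `e = c' / c`
  -- equals `u' * star u / (-p)`, and `-p` is an `l`-adic unit.
  have h : star (↑(c' * c⁻¹) : K ℚ_[l] d) * (↑(c' * c⁻¹)⁻¹ : K ℚ_[l] d) =
      (-(p : ℚ_[l])⁻¹) • ((↑c'⁻¹ : K ℚ_[l] d) * (a * star (c' : K ℚ_[l] d)) *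
        star ((↑c⁻¹ : K ℚ_[l] d) * (a * star (c : K ℚ_[l] d)))) := by
    have h1 : (↑c'⁻¹ : K ℚ_[l] d) * (a * star (c' : K ℚ_[l] d)) *
        star ((↑c⁻¹ : K ℚ_[l] d) * (a * star (c : K ℚ_[l] d))) = -(p : K ℚ_[l] d) *
          (star (↑(c' * c⁻¹) : K ℚ_[l] d) * (↑(c' * c⁻¹)⁻¹ : K ℚ_[l] d)) := by
      rw [mul_inv_rev, inv_inv, Units.val_mul, Units.val_mul, star_mul', star_mul', star_mul',
        star_star, ← ha]
      ring
    rw [h1, ← smul_mul_assoc]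
    have h2 : (-(p : ℚ_[l])⁻¹) • (-(p : K ℚ_[l] d)) = 1 := by
      ext <;> simp [QuadraticAlgebra.re_one, QuadraticAlgebra.im_one, hp0]
    rw [h2, one_mul]
  rw [h]
  refine smul_mem_of_norm_le_one (L := Subalgebra.toSubmodule (OAt l O)) ?_ hmem
  rw [norm_neg, norm_inv, hpl, inv_one]

/-- The class of a cocycle trivialized by `c` acts on the optimal maximal orders as the
conjugation by `c`. -/
theorem exists_addAction (hd : 0 < d) (hp : p ≠ 0) (hO : IsOrder ℤ ℚ O)
    (hpl : ‖(p : ℚ_[l])‖ = 1) {a : K ℚ_[l] d} (ha : a * star a = -(p : K ℚ_[l] d)) :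
    ∃ _ : AddAction (H1 (unitsRep hd hO l)) (SOpt l p O),
      (∀ R : SOpt l p O, Function.Bijective (fun h : H1 (unitsRep hd hO l) => h +ᵥ R)) ∧
      ∀ (z : cocycles₁ (unitsRep hd hO l)) (c : (K ℚ_[l] d)ˣ), IsTrivializedBy hd hO z c →
        ∀ R : SOpt l p O, (H1π (unitsRep hd hO l) z +ᵥ R : SOpt l p O).1 = conjOrder c R.1 := by
  have hsurj (h : H1 (unitsRep hd hO l)) : ∃ z, H1π (unitsRep hd hO l) z = h :=
    H1_induction_on h fun z => ⟨z, rfl⟩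
  choose z hz using hsurj
  choose c hc using fun h => exists_isTrivializedBy (z h)
  -- `c / c'` trivializes `z - z'`. One direction makes the action independent of the chosen cocycle
  -- and of `c`; the other makes it free.
  have hfix {z z' : cocycles₁ (unitsRep hd hO l)} {c c' : (K ℚ_[l] d)ˣ}
      (h : IsTrivializedBy hd hO z c) (h' : IsTrivializedBy hd hO z' c') (R : SOpt l p O) :
      conjOrder c R.1 = conjOrder c' R.1 ↔
        H1π (unitsRep hd hO l) z = H1π (unitsRep hd hO l) z' := by
    rw [← sub_eq_zero (a := H1π _ z), ← map_sub, (h.sub h').H1π_eq_zero_iff,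
      ← conjOrder_eq_self_iff hd hp ha hO R.2, mul_comm, conjOrder_mul]
    constructor
    · intro h
      rw [h, ← conjOrder_mul, inv_mul_cancel, conjOrder_one]
    · intro h
      have h1 := congrArg (conjOrder c') h
      rwa [← conjOrder_mul, mul_inv_cancel, conjOrder_one] at h1
  let act (h : H1 (unitsRep hd hO l)) (R : SOpt l p O) : SOpt l p O :=
    ⟨conjOrder (c h) R.1, conjOrder_mem_SOpt R.2 (hc h).star_inv_mul_mem⟩
  have hact (w : cocycles₁ (unitsRep hd hO l)) (e : (K ℚ_[l] d)ˣ) (h : IsTrivializedBy hd hO w e)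
      (R : SOpt l p O) : (act (H1π (unitsRep hd hO l) w) R).1 = conjOrder e R.1 :=
    (hfix (hc _) h R).2 (hz _)
  have hzero (R : SOpt l p O) : act 0 R = R := by
    have h := hact 0 1 isTrivializedBy_zero_one R
    rw [map_zero, conjOrder_one] at h
    exact Subtype.ext h
  have hadd (g h : H1 (unitsRep hd hO l)) (R : SOpt l p O) : act (g + h) R = act g (act h R) := by
    have h1 := hact _ _ ((hc g).add (hc h)) R
    have h2 : H1π (unitsRep hd hO l) (z g + z h) = g + h := by
      rw [map_add, hz, hz]
    rw [h2, conjOrder_mul] at h1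
    exact Subtype.ext h1
  refine ⟨
    { vadd := act
      zero_vadd := hzero
      add_vadd := hadd }, fun R => ⟨fun g h hgh => ?_, fun R' => ?_⟩, hact⟩
  · have h1 := (hfix (hc g) (hc h) R).1 (congrArg Subtype.val hgh)
    rwa [hz, hz] at h1
  · obtain ⟨e, he, heR⟩ := exists_conjOrder_eq hd hp hO hpl ha R.2 R'.2
    obtain ⟨w, hw⟩ := exists_isTrivializedBy_of_mem (hd := hd) (hO := hO) e he
    exact ⟨H1π _ w, Subtype.ext ((hact w e hw R).trans heR)⟩

end Action

end OptimalOrders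

end

/-! ### The theorem -/

open OptimalOrders
theorem lemma3p2 (d p : ℕ) (hd : 0 < d) (hdsq : Squarefree d) (hp : p.Prime)
    (O : Subalgebra ℤ (K ℚ d)) (hO : IsOrder ℤ ℚ O)
    (hinert : IsInert d p) (hlt : |disc O| < (p : ℤ))
    (hram : IsRamifiedPreciselyAtPAndInfinity d p)
    (l : ℕ) [Fact l.Prime] (hl : (l : ℤ) ∣ disc O) :
    ((SOpt l p O).Nonempty ↔
      ∃ u : (OAt l O)ˣ, Algebra.norm ℚ_[l] ((u : OAt l O) : K ℚ_[l] d) = -(p : ℚ_[l])) ∧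
    ((SOpt l p O).Nonempty →
      ∃ _ : AddAction (groupCohomology.H1 (unitsRep hd hO l)) (SOpt l p O),
        (∀ R : SOpt l p O, Function.Bijective
          (fun h : groupCohomology.H1 (unitsRep hd hO l) => h +ᵥ R)) ∧
        (∀ (z : groupCohomology.cocycles₁ (unitsRep hd hO l)) (c : (K ℚ_[l] d)ˣ),
          (∀ s : K ℚ d ≃ₐ[ℚ] K ℚ d, galAt ℚ_[l] s c = cocycleValue hd hO l z s * c) →
          ∀ R : SOpt l p O,
            ((groupCohomology.H1π (unitsRep hd hO l) z +ᵥ R : SOpt l p O).1 :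
                Set (B ℚ_[l] d p)) =
              (fun x => toB ℚ_[l] d p c * x * toB ℚ_[l] d p (↑c⁻¹ : K ℚ_[l] d)) ''
                (R.1 : Set (B ℚ_[l] d p)))) := by
  have hlp : l < p := by
    have h := Int.le_of_dvd (abs_pos.2 (disc_ne_zero hd hO)) ((dvd_abs _ _).2 hl)
    exact_mod_cast h.trans_lt hlt
  have hsplit : Nonempty (B ℚ_[l] d p ≃ₐ[ℚ_[l]] Matrix (Fin 2) (Fin 2) ℚ_[l]) := by
    by_contra h
    exact hlp.ne ((hram.2 l).1 h)
  have hpl : ‖(p : ℚ_[l])‖ = 1 := by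
    rw [Padic.norm_natCast_eq_one_iff]
    exact (Nat.coprime_primes Fact.out hp).2 hlp.ne
  have hnorm (u : (OAt l O)ˣ) :
      Algebra.norm ℚ_[l] ((u : OAt l O) : K ℚ_[l] d) = -(p : ℚ_[l]) ↔
        ((u : OAt l O) : K ℚ_[l] d) * star ((u : OAt l O) : K ℚ_[l] d) = -(p : K ℚ_[l] d) := by
    rw [algebraNorm_eq_norm, ← QuadraticAlgebra.algebraMap_norm_eq_mul_star,
      ← QuadraticAlgebra.algebraMap_inj (a := -(d : ℚ_[l])) (b := 0), map_neg, map_natCast]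
  have hiff := SOpt_nonempty_iff hd hp.ne_zero hO hpl hsplit
  simp only [hnorm]
  refine ⟨hiff, fun hne => ?_⟩
  -- The unit `u` of norm `-p` can itself serve as the element `a` defining the action on `K_ℓ`.
  obtain ⟨u, hu⟩ := hiff.1 hne
  obtain ⟨act, hbij, hact⟩ := exists_addAction hd hp.ne_zero hO hpl hu
  refine ⟨act, hbij, fun z c hc R => ?_⟩
  rw [hact z c hc R, coe_conjOrder]
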